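/- Let $n\ge 1$ be an integer. Write $\mathcal H_1=\mathcal H_2=L^2(\mathbb R,dx)$ (complex valued), and let $dA$ be Lebesgue measure on $\mathbb C$. **Weights.** With $I_\nu(t)=(t/2)^\nu\sum_{l\ge0}\frac{(t/2)^{2l}}{\Gamma(l+\nu+1)\,l!}$ and $K_\nu=\frac{\pi}{2\sin\nu\pi}(I_{-\nu}-I_\nu)$, put $$\rho_1(z,\bar z)=C_n\,|z|^{2n-1}K_{1-\frac1{2n}}\!\Big(\frac{|z|^{2n}}{n}\Big),\qquad \rho_2(z,\bar z)=C_n\,|z|^{2n-1}K_{\frac1{2n}}\!\Big(\frac{|z|^{2n}}{n}\Big),\qquad C_n=\frac{2}{(2n)^{\frac1{2n}}\pi\,\Gamma(\frac1{2n})}.$$ **Spaces.** For $k\ge 0$ put $$e_{2k}(z)=\sqrt{\tfrac{\Gamma(\frac1{2n})}{(2n)^{2k}\Gamma(k+\frac1{2n})k!}}\,z^{2nk},\qquad e_{2k+1}(z)=\sqrt{\tfrac{\Gamma(\frac1{2n})}{(2n)^{2k+2-\frac1n}\Gamma(k+2-\frac1{2n})k!}}\,z^{2nk+2n-1},$$ $$\tilde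 e_{2k}(z)=\sqrt{\tfrac{\Gamma(\frac1{2n})}{(2n)^{2k+1-\frac1n}\Gamma(k+1-\frac1{2n})k!}}\,z^{2nk+n-1},\qquad \tilde e_{2k+1}(z)=\sqrt{\tfrac{\Gamma(\frac1{2n})}{(2n)^{2k+1}\Gamma(k+1+\frac1{2n})k!}}\,z^{2nk+n}.$$ Let $\mathcal O_1=\operatorname{span}\{e_l\}$, $\mathcal O_2=\operatorname{span}\{\tilde e_l\}$, $\mathfrak F_1=\{\sum_l c_le_l:\sum_l|c_l|^2<\infty\}$ and $\mathfrak F_2=\{\sum_l d_l\tilde e_l:\sum_l|d_l|^2<\infty\}$; these are spaces of functions on $\mathbb C$, the series being summed pointwise. **Transforms.** With $\alpha=n^{\frac12-\frac1{4n}}\Gamma(\frac1{2n})^{1/2}$ and $\beta=2^{-\frac12+\frac1{2n}}n^{-\frac12+\frac3{4n}}\Gamma(\frac1{2n})^{1/2}$ put $$B_1(z,x)=\alpha\sum_{l\ge0}\frac{2^l(zx)^{2nl}}{(2n)^{2l}\Gamma(l+\frac1{2n})l!}+\beta\sum_{l\ge0}\frac{2^{l+\frac12}(zx)^{2nl+2n-1}}{(2n)^{2l+1}\Gamma(l+2-\frac1{2n})l!},$$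 $$B_2(z,x)=\beta\sum_{l\ge0}\frac{2^l(zx)^{2nl+n-1}}{(2n)^{2l}\Gamma(l+1-\frac1{2n})l!}+\alpha\sum_{l\ge0}\frac{2^{l+\frac12}(zx)^{2nl+n}}{(2n)^{2l+1}\Gamma(l+1+\frac1{2n})l!},$$ and, for $j=1,2$, $A_j(z,x)=e^{-z^{2n}/(2n)}B_j(z,x)e^{-x^{2n}/(2n)}$. The coupled SUSY Segal–Bargmann transforms are $\mathcal B_jf(z)=\int_{\mathbb R}A_j(z,x)f(x)\,dx$ for $f\in\mathcal H_j$. **Corollary (inverse transforms).** For $j=1,2$, the integral defining $\mathcal B_jf(z)$ converges absolutely for all $f\in\mathcal H_j$ and $z\in\mathbb C$, and $\mathcal B_j$ is a linear bijection of $\mathcal H_j$ onto $\mathfrak F_j$. Its inverse $\mathcal B_j^{-1}:\mathfrak F_j\to\mathcal H_j$ is given by $$\mathcal B_j^{-1}f(x)=\int_{\mathbb C}A_j(\bar z,x)\,f(z)\,\rho_j(z,\bar z)\,dA(z),$$ where for general $f\in\mathfrak F_j$ the integral is understood as a limit in the mean: 1. for every $f\in\mathfrak F_j$, the integrals $\int_{|z|\le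 R}A_j(\bar z,x)f(z)\rho_j(z,\bar z)\,dA(z)$ converge absolutely for all $R$ and $x$, are in $L^2(\mathbb R,dx)$ as functions of $x$, and converge in $L^2(\mathbb R,dx)$ to $\mathcal B_j^{-1}f$ as $R\to\infty$; 2. for every $f\in\mathfrak F_j$ and almost every $x\in\mathbb R$, if the integral over $\mathbb C$ converges absolutely at $x$, then it equals $\mathcal B_j^{-1}f(x)$; 3. $\mathcal O_j\subseteq\mathfrak F_j$, and for $f\in\mathcal O_j$ the integral over $\mathbb C$ converges absolutely for every $x\in\mathbb R$ (so by 2 the formula then holds for almost every $x$). -/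

import Mathlib

open MeasureTheory Filter Topology ComplexConjugate

namespace CoupledSUSY

noncomputable section

/-- The modified Bessel function of the first kind `I_ν`, at positive real argument. -/
def besselI (ν x : ℝ) : ℝ :=
  (x / 2) ^ ν * ∑' l : ℕ, 1 / (Real.Gamma (l + ν + 1) * (l.factorial : ℝ)) * (x / 2) ^ (2 * l)

/-- The modified Bessel function of the second kind `K_ν`, for non-integer `ν`,
at positive real argument. -/
def besselK (ν x : ℝ) : ℝ :=
  Real.pi / (2 * Real.sin (ν * Real.pi)) * (besselI (-ν) x - besselI ν x)

/-- The common normalization of the two weights. -/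
def weightConst (n : ℕ) : ℝ :=
  2 / ((2 * n : ℝ) ^ (1 / (2 * n : ℝ)) * Real.pi * Real.Gamma (1 / (2 * n : ℝ)))

/-- The weight `ρ₁(z, z̄)`; here `z z̄ = ‖z‖ ^ 2`. -/
def rho₁ (n : ℕ) (z : ℂ) : ℝ :=
  weightConst n * (‖z‖ ^ 2) ^ ((n : ℝ) - 1 / 2) *
    besselK (1 - 1 / (2 * n : ℝ)) ((‖z‖ ^ 2) ^ n / n)

/-- The weight `ρ₂(z, z̄)`. -/
def rho₂ (n : ℕ) (z : ℂ) : ℝ :=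
  weightConst n * (‖z‖ ^ 2) ^ ((n : ℝ) - 1 / 2) *
    besselK (1 / (2 * n : ℝ)) ((‖z‖ ^ 2) ^ n / n)

/-- The exponent of the monomial `e_l`: `2nk` for `l = 2k`, `2nk + 2n - 1` for `l = 2k + 1`. -/
def expo₁ (n l : ℕ) : ℕ :=
  if Even l then 2 * n * (l / 2) else 2 * n * (l / 2) + (2 * n - 1)

/-- The exponent of the monomial `ẽ_l`: `2nk + n - 1` for `l = 2k`, `2nk + n` for `l = 2k + 1`. -/
def expo₂ (n l : ℕ) : ℕ :=
  if Even l then 2 * n * (l / 2) + (n - 1) else 2 * n * (l / 2) + n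

/-- The normalization of `e_l`, where `k = l / 2` is the integer part. -/
def coeff₁ (n l : ℕ) : ℝ :=
  if Even l then
    √(Real.Gamma (1 / (2 * n : ℝ)) /
      ((2 * n : ℝ) ^ (2 * ((l / 2 : ℕ) : ℝ)) *
        Real.Gamma (((l / 2 : ℕ) : ℝ) + 1 / (2 * n : ℝ)) * ((l / 2).factorial : ℝ)))
  else
    √(Real.Gamma (1 / (2 * n : ℝ)) /
      ((2 * n : ℝ) ^ (2 * ((l / 2 : ℕ) : ℝ) + 2 - 1 / (n : ℝ)) *
        Real.Gamma (((l / 2 : ℕ) : ℝ) + 2 - 1 / (2 * n : ℝ)) * ((l / 2).factorial : ℝ)))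

/-- The normalization of `ẽ_l`, where `k = l / 2` is the integer part. -/
def coeff₂ (n l : ℕ) : ℝ :=
  if Even l then
    √(Real.Gamma (1 / (2 * n : ℝ)) /
      ((2 * n : ℝ) ^ (2 * ((l / 2 : ℕ) : ℝ) + 1 - 1 / (n : ℝ)) *
        Real.Gamma (((l / 2 : ℕ) : ℝ) + 1 - 1 / (2 * n : ℝ)) * ((l / 2).factorial : ℝ)))
  else
    √(Real.Gamma (1 / (2 * n : ℝ)) /
      ((2 * n : ℝ) ^ (2 * ((l / 2 : ℕ) : ℝ) + 1) *
        Real.Gamma (((l / 2 : ℕ) : ℝ) + 1 + 1 / (2 * n : ℝ)) * ((l / 2).factorial : ℝ)))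

/-- The normalized monomials `e_l`. -/
def e₁ (n l : ℕ) (z : ℂ) : ℂ := (coeff₁ n l : ℂ) * z ^ expo₁ n l

/-- The normalized monomials `ẽ_l`. -/
def e₂ (n l : ℕ) (z : ℂ) : ℂ := (coeff₂ n l : ℂ) * z ^ expo₂ n l

/-- `𝒪₁(ℂ) = span {1, z^(2n-1), z^(2n), z^(4n-1), z^(4n), …}`. -/
def O₁ (n : ℕ) : Submodule ℂ (ℂ → ℂ) :=
  Submodule.span ℂ (Set.range fun l : ℕ => fun z : ℂ => z ^ expo₁ n l)

/-- `𝒪₂(ℂ) = span {z^(n-1), z^n, z^(3n-1), z^(3n), …}`. -/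
def O₂ (n : ℕ) : Submodule ℂ (ℂ → ℂ) :=
  Submodule.span ℂ (Set.range fun l : ℕ => fun z : ℂ => z ^ expo₂ n l)

/-- The functions `∑ c_l u_l` (pointwise sums) with square-summable coefficients. -/
def l2Series (u : ℕ → ℂ → ℂ) : Submodule ℂ (ℂ → ℂ) where
  carrier := {f | ∃ c : ℕ → ℂ, Memℓp c 2 ∧ ∀ z, HasSum (fun l => c l * u l z) (f z)}
  zero_mem' := ⟨0, zero_memℓp, fun z => by simp⟩
  add_mem' := by
    rintro f g ⟨c, hc, hf⟩ ⟨d, hd, hg⟩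
    exact ⟨c + d, hc.add hd, fun z => by simpa [add_mul] using (hf z).add (hg z)⟩
  smul_mem' := by
    rintro a f ⟨c, hc, hf⟩
    exact ⟨a • c, hc.const_smul a, fun z => by
      simpa [mul_assoc] using (hf z).mul_left a⟩

/-- The first coupled SUSY Segal-Bargmann space. -/
def F₁ (n : ℕ) : Submodule ℂ (ℂ → ℂ) := l2Series (e₁ n)

/-- The second coupled SUSY Segal-Bargmann space. -/
def F₂ (n : ℕ) : Submodule ℂ (ℂ → ℂ) := l2Series (e₂ n)

/-- The constant `α = n^(1/2 - 1/(4n)) Γ(1/(2n))^(1/2)`. -/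
def alpha (n : ℕ) : ℝ :=
  (n : ℝ) ^ (1 / 2 - 1 / (4 * n : ℝ)) * √(Real.Gamma (1 / (2 * n : ℝ)))

/-- The constant `β = 2^(-1/2 + 1/(2n)) n^(-1/2 + 3/(4n)) Γ(1/(2n))^(1/2)`. -/
def beta (n : ℕ) : ℝ :=
  (2 : ℝ) ^ (-(1 / 2) + 1 / (2 * n : ℝ)) * (n : ℝ) ^ (-(1 / 2) + 3 / (4 * n : ℝ)) *
    √(Real.Gamma (1 / (2 * n : ℝ)))

/-- The reduced kernel `B₁(z, x) = e^(z^(2n)/(2n)) A₁(z, x) e^(x^(2n)/(2n))`. -/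
def kerB₁ (n : ℕ) (z : ℂ) (x : ℝ) : ℂ :=
  (alpha n : ℂ) * ∑' l : ℕ,
      (((2 : ℝ) ^ l / ((2 * n : ℝ) ^ (2 * l) * Real.Gamma (l + 1 / (2 * n : ℝ)) *
        (l.factorial : ℝ)) : ℝ) : ℂ) * (z * x) ^ (2 * n * l) +
  (beta n : ℂ) * ∑' l : ℕ,
      (((2 : ℝ) ^ ((l : ℝ) + 1 / 2) / ((2 * n : ℝ) ^ (2 * l + 1) *
        Real.Gamma (l + 2 - 1 / (2 * n : ℝ)) * (l.factorial : ℝ)) : ℝ) : ℂ) *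
        (z * x) ^ (2 * n * l + (2 * n - 1))

/-- The reduced kernel `B₂(z, x) = e^(z^(2n)/(2n)) A₂(z, x) e^(x^(2n)/(2n))`. -/
def kerB₂ (n : ℕ) (z : ℂ) (x : ℝ) : ℂ :=
  (beta n : ℂ) * ∑' l : ℕ,
      (((2 : ℝ) ^ l / ((2 * n : ℝ) ^ (2 * l) * Real.Gamma (l + 1 - 1 / (2 * n : ℝ)) *
        (l.factorial : ℝ)) : ℝ) : ℂ) * (z * x) ^ (2 * n * l + (n - 1)) +
  (alpha n : ℂ) * ∑' l : ℕ,
      (((2 : ℝ) ^ ((l : ℝ) + 1 / 2) / ((2 * n : ℝ) ^ (2 * l + 1) *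
        Real.Gamma (l + 1 + 1 / (2 * n : ℝ)) * (l.factorial : ℝ)) : ℝ) : ℂ) *
        (z * x) ^ (2 * n * l + n)

/-- The integral kernel `A₁`. -/
def A₁ (n : ℕ) (z : ℂ) (x : ℝ) : ℂ :=
  Complex.exp (-z ^ (2 * n) / (2 * n)) * kerB₁ n z x * Complex.exp (-(x : ℂ) ^ (2 * n) / (2 * n))

/-- The integral kernel `A₂`. -/
def A₂ (n : ℕ) (z : ℂ) (x : ℝ) : ℂ :=
  Complex.exp (-z ^ (2 * n) / (2 * n)) * kerB₂ n z x * Complex.exp (-(x : ℂ) ^ (2 * n) / (2 * n))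

/-- `ℋ₁ = ℋ₂ = L²(ℝ, dx)`. -/
abbrev H : Type := Lp ℂ 2 (volume : Measure ℝ)

/-- The transform `ℬ₁ f(z) = ∫ A₁(z, x) f(x) dx`. -/
def B₁ (n : ℕ) (f : H) (z : ℂ) : ℂ := ∫ x : ℝ, A₁ n z x * f x

/-- The transform `ℬ₂ f(z) = ∫ A₂(z, x) f(x) dx`. -/
def B₂ (n : ℕ) (f : H) (z : ℂ) : ℂ := ∫ x : ℝ, A₂ n z x * f x

/-- The integrand of the inversion formula for `ℬ₁`. -/
def invIntegrand₁ (n : ℕ) (f : ℂ → ℂ) (x : ℝ) (z : ℂ) : ℂ :=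
  A₁ n (conj z) x * f z * (rho₁ n z : ℂ)

/-- The integrand of the inversion formula for `ℬ₂`. -/
def invIntegrand₂ (n : ℕ) (f : ℂ → ℂ) (x : ℝ) (z : ℂ) : ℂ :=
  A₂ n (conj z) x * f z * (rho₂ n z : ℂ)

end

end CoupledSUSY

/-!
For each of the two transforms, the kernel is diagonal: with respect to an orthonormal basis `ψ_l` of
`L²(ℝ)` it is `A(z, x) = ∑ γ_l z ^ m_l ψ_l(x)`, where the normalized monomials `γ_l z ^ m_l` are
orthonormal for the weight `ρ`. The transform therefore carries `ψ_l` to `γ_l z ^ m_l`, and it is the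
composition of the coordinate map of the basis with the summation of series
(`DiagonalKernel.inversion`). As `ρ` is radial, distinct monomials are orthogonal on every disc, so
the inversion integral over the disc of radius `R` of `∑ c_l γ_l z ^ m_l` is `∑ c_l λ_l(R) ψ_l(x)`,
where `λ_l(R) ∈ [0, 1]` is the part of the norm of the `l`-th monomial inside the disc. Since
`λ_l(R) → 1`, this converges in the mean to `∑ c_l ψ_l`. A subsequence converges almost everywhere,
which identifies the limit with the full integral wherever that converges absolutely.

It remains to exhibit this structure. Both kernels are sums of two sectors, one for the exponents
`2nk + b` and one for the exponents `2nk + (2n - 1 - b)`, with `b = 0` for the first transform and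
`b = n - 1` for the second. In the sector of `a` put `s = (2a + 1) / (2n)`.

* Expanding `e^(-z^(2n)/(2n))` times the Bessel-type series by the Cauchy product gives `ψ` as `x ^ a`
  times a Laguerre polynomial in `x ^ (2n) / n` of parameter `s - 1` (`hasSum_sectorKernel`). Its
  orthogonality is the statement that the `k`-th finite difference of a polynomial of degree below
  `k` vanishes (`sum_choose_mul_ascPochhammer`). The two sectors have opposite parity.
* The family is complete (`exists_hilbertBasis`): a function orthogonal to it has, against
  `x ^ a e^(-x^(2n)/(2n))`, vanishing moments in the variable `x ^ (2n)`, and exponential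
  integrability makes this moment problem determinate
  (`setIntegral_preimage_eq_zero_of_moments`).
* The function `K_μ`, defined by power series, has the integral representation `besselK_eq`. It shows
  that the weight is positive and decays at least like `e^(-3|z|^(2n)/(4n))` (`besselWeight_le`),
  and by Tonelli's theorem it gives the moments as products of two Gamma values
  (`besselInt_moment`), which are the normalizations of the monomials
  (`integral_sectorCoeff_sq_mul_besselWeight`). The decay beats the growth
  `e^(5|z|^(2n)/(8n))` of the kernel (`norm_sectorKernel_le`), so the inversion integral of a
  monomial converges absolutely.
-/

namespace CoupledSUSY

/-! ### Inversion of an integral transform given by a diagonal kernel -/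

/-- The data of a transform that carries an orthonormal basis `b` of `L²(ℝ)`, represented by the
real functions `ψ l`, to the normalized monomials `γ l * z ^ m l`, which are orthonormal with
respect to the radial weight `ρ`; its kernel is `A z x = ∑ γ l * z ^ m l * ψ l x`. The last field
says that the inversion integral of every monomial converges absolutely. -/
structure DiagonalKernel (b : HilbertBasis ℕ ℂ H) (ψ : ℕ → ℝ → ℝ) (γ : ℕ → ℝ) (m : ℕ → ℕ)
    (A : ℂ → ℝ → ℂ) (ρ : ℂ → ℝ) : Prop where
  basis_ae : ∀ l, (b l : ℝ → ℂ) =ᵐ[volume] fun x => (ψ l x : ℂ)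
  coeff_ne : ∀ l, γ l ≠ 0
  injective_exp : Function.Injective m
  kernel : ∀ z x, HasSum (fun l => ((γ l : ℂ) * z ^ m l) * (ψ l x : ℂ)) (A z x)
  summable_sq : ∀ r : ℝ, Summable fun l => (γ l * r ^ m l) ^ 2
  weight_meas : Measurable ρ
  weight_nonneg : ∀ z, 0 ≤ ρ z
  weight_radial : ∀ z w : ℂ, ‖z‖ = ‖w‖ → ρ z = ρ w
  weight_loc : ∀ R : ℝ, IntegrableOn ρ (Metric.closedBall 0 R)
  moment_int : ∀ l, Integrable fun z : ℂ => (γ l * ‖z‖ ^ m l) ^ 2 * ρ z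
  moment : ∀ l, ∫ z : ℂ, (γ l * ‖z‖ ^ m l) ^ 2 * ρ z = 1
  decay : ∀ l x, Integrable fun z : ℂ => A (conj z) x * z ^ m l * (ρ z : ℂ)

namespace DiagonalKernel

lemma _root_.Measurable.of_hasSum {X : Type*} [MeasurableSpace X] {f : ℕ → X → ℂ} {g : X → ℂ}
    (hf : ∀ l, Measurable (f l)) (h : ∀ x, HasSum (fun l => f l x) (g x)) : Measurable g := by
  refine measurable_of_tendsto_metrizable (f := fun N x => ∑ l ∈ Finset.range N, f l x)
    (fun N => Finset.measurable_sum _ fun i _ => hf i) ?_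
  rw [tendsto_pi_nhds]
  exact fun x => (h x).tendsto_sum_nat

/-- Mean-square sums and pointwise sums of an orthogonal series agree almost everywhere. -/
lemma repr_symm_ae_eq {b : HilbertBasis ℕ ℂ H} {ψ : ℕ → ℝ → ℝ}
    (hb : ∀ l, (b l : ℝ → ℂ) =ᵐ[volume] fun x => (ψ l x : ℂ))
    (c : lp (fun _ : ℕ => ℂ) 2) {G : ℝ → ℂ}
    (hG : ∀ x, HasSum (fun l => c l * (ψ l x : ℂ)) (G x)) :
    (b.repr.symm c : ℝ → ℂ) =ᵐ[volume] G := by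
  have h1 := tendstoInMeasure_of_tendsto_Lp (b.hasSum_repr_symm c).tendsto_sum_nat
  obtain ⟨ns, hns, h2⟩ := h1.exists_seq_tendsto_ae
  have h3 : ∀ᵐ x : ℝ, ∀ N : ℕ, ((∑ l ∈ Finset.range N, c l • b l : H) : ℝ → ℂ) x
      = ∑ l ∈ Finset.range N, c l * (ψ l x : ℂ) := by
    rw [ae_all_iff]
    intro N
    induction N with
    | zero =>
      filter_upwards with x
      simp
    | succ N ih =>
      rw [Finset.sum_range_succ]
      filter_upwards [ih, Lp.coeFn_add (∑ l ∈ Finset.range N, c l • b l : H) (c N • b N),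
        Lp.coeFn_smul (c N) (b N), hb N] with x h1 h2 h3 h4
      rw [h2, Pi.add_apply, h1, h3, Pi.smul_apply, h4, Finset.sum_range_succ, smul_eq_mul]
  filter_upwards [h2, h3] with x hx hx'
  refine tendsto_nhds_unique hx ?_
  simp only [hx']
  exact (hG x).tendsto_sum_nat.comp hns.tendsto_atTop

/-- A radial weight makes distinct monomials orthogonal on every disc. -/
lemma integral_conj_pow_mul_pow {ρ : ℂ → ℝ} (hρ : ∀ z w : ℂ, ‖z‖ = ‖w‖ → ρ z = ρ w) (R : ℝ)
    {p q : ℕ} (hpq : p ≠ q) :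
    ∫ z in Metric.closedBall (0 : ℂ) R, conj z ^ p * z ^ q * (ρ z : ℂ) = 0 := by
  -- the rotation by `ζ` multiplies the integrand by `ζ ^ (q - p) = -1`
  set θ : ℝ := Real.pi / ((q : ℝ) - p) with hθ
  have hne : ((q : ℝ) - p) ≠ 0 := by
    rw [sub_ne_zero]; exact_mod_cast hpq.symm
  set ζ : Circle := Circle.exp θ
  have hζ : conj (ζ : ℂ) ^ p * (ζ : ℂ) ^ q = -1 := by
    have : conj (ζ : ℂ) = Complex.exp (-(θ * Complex.I)) := by
      simp only [ζ, Circle.coe_exp, ← Complex.exp_conj]; simp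
    rw [this]
    simp only [ζ, Circle.coe_exp]
    rw [← Complex.exp_nat_mul, ← Complex.exp_nat_mul, ← Complex.exp_add, ← Complex.exp_pi_mul_I]
    congr 1
    have : (θ : ℂ) * ((q : ℂ) - p) = Real.pi := by
      rw [hθ]; push_cast
      have : ((q : ℂ) - p) ≠ 0 := by exact_mod_cast hne
      field_simp
    linear_combination Complex.I * this
  set F : ℂ → ℂ := fun z => conj z ^ p * z ^ q * (ρ z : ℂ)
  have hmp : MeasurePreserving (rotation ζ) (volume : Measure ℂ) volume :=
    (rotation ζ).measurePreserving
  have hme : MeasurableEmbedding (rotation ζ) :=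
    (rotation ζ).toHomeomorph.measurableEmbedding
  have h := hmp.setIntegral_preimage_emb hme F (Metric.closedBall (0 : ℂ) R)
  have hpre : (rotation ζ) ⁻¹' Metric.closedBall (0 : ℂ) R = Metric.closedBall 0 R := by
    ext z
    rw [Set.mem_preimage, mem_closedBall_zero_iff, mem_closedBall_zero_iff,
      LinearIsometryEquiv.norm_map]
  rw [hpre] at h
  have hF : ∀ z, F (rotation ζ z) = - F z := by
    intro z
    simp only [F, rotation_apply, map_mul, mul_pow]
    rw [hρ (ζ * z) z (by rw [norm_mul, Circle.norm_coe, one_mul])]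
    linear_combination (conj z ^ p * z ^ q * (ρ z : ℂ)) * hζ
  simp only [hF, integral_neg] at h
  have h2 : (2 : ℂ) * ∫ z in Metric.closedBall (0 : ℂ) R, F z = 0 := by
    linear_combination -h
  simpa using h2

variable {b : HilbertBasis ℕ ℂ H} {ψ : ℕ → ℝ → ℝ} {γ : ℕ → ℝ} {m : ℕ → ℕ}
    {A : ℂ → ℝ → ℂ} {ρ : ℂ → ℝ}

/-- The coefficients of `A z ·` in the basis. -/
noncomputable def kernelCoeff (D : DiagonalKernel b ψ γ m A ρ) (z : ℂ) : lp (fun _ : ℕ => ℂ) 2 :=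
  ⟨fun l => (γ l : ℂ) * z ^ m l, by
    refine memℓp_gen ?_
    refine (D.summable_sq ‖z‖).congr fun l => ?_
    simp [mul_pow]⟩

lemma kernelCoeff_apply (D : DiagonalKernel b ψ γ m A ρ) (z : ℂ) (l : ℕ) :
    D.kernelCoeff z l = (γ l : ℂ) * z ^ m l := rfl

lemma kernel_ae (D : DiagonalKernel b ψ γ m A ρ) (z : ℂ) :
    (b.repr.symm (D.kernelCoeff z) : ℝ → ℂ) =ᵐ[volume] A z :=
  repr_symm_ae_eq D.basis_ae _ (D.kernel z)

lemma conj_kernel (D : DiagonalKernel b ψ γ m A ρ) (z : ℂ) (x : ℝ) :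
    conj (A (conj z) x) = A z x := by
  have h := (D.kernel (conj z) x).map (starRingEnd ℂ) Complex.continuous_conj
  refine h.unique ?_
  convert D.kernel z x using 2 with l
  simp

lemma integrable_kernel_mul (D : DiagonalKernel b ψ γ m A ρ) (f : H) (z : ℂ) :
    Integrable (fun x : ℝ => A z x * f x) := by
  refine (L2.integrable_inner (𝕜 := ℂ) (b.repr.symm (D.kernelCoeff (conj z))) f).congr ?_
  filter_upwards [D.kernel_ae (conj z)] with x hx
  rw [hx, RCLike.inner_apply, D.conj_kernel, mul_comm]

lemma hasSum_transform (D : DiagonalKernel b ψ γ m A ρ) (f : H) (z : ℂ) :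
    HasSum (fun l => b.repr f l * ((γ l : ℂ) * z ^ m l)) (∫ x : ℝ, A z x * f x) := by
  have h1 : ∫ x : ℝ, A z x * f x = inner ℂ (D.kernelCoeff (conj z)) (b.repr f) := by
    rw [← b.repr.symm.inner_map_map, LinearIsometryEquiv.symm_apply_apply, L2.inner_def]
    refine integral_congr_ae ?_
    filter_upwards [D.kernel_ae (conj z)] with x hx
    rw [hx, RCLike.inner_apply, D.conj_kernel, mul_comm]
  rw [h1]
  have h2 := lp.hasSum_inner (𝕜 := ℂ) (D.kernelCoeff (conj z)) (b.repr f)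
  simpa [kernelCoeff_apply, RCLike.inner_apply] using h2

lemma hasSum_series (D : DiagonalKernel b ψ γ m A ρ) (c : lp (fun _ : ℕ => ℂ) 2) (z : ℂ) :
    Summable (fun l => c l * ((γ l : ℂ) * z ^ m l)) := by
  refine (lp.summable_inner (𝕜 := ℂ) (D.kernelCoeff (conj z)) c).congr fun l => ?_
  simp [kernelCoeff_apply, RCLike.inner_apply]

/-- The part of the norm of `γ l * z ^ m l` that lies in the disc of radius `R`. -/
noncomputable def discNorm (γ : ℕ → ℝ) (m : ℕ → ℕ) (ρ : ℂ → ℝ) (l : ℕ) (R : ℝ) : ℝ :=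
  ∫ z in Metric.closedBall (0 : ℂ) R, (γ l * ‖z‖ ^ m l) ^ 2 * ρ z

lemma discNorm_nonneg (D : DiagonalKernel b ψ γ m A ρ) (l : ℕ) (R : ℝ) :
    0 ≤ discNorm γ m ρ l R :=
  integral_nonneg fun z => mul_nonneg (sq_nonneg _) (D.weight_nonneg z)

lemma discNorm_le_one (D : DiagonalKernel b ψ γ m A ρ) (l : ℕ) (R : ℝ) :
    discNorm γ m ρ l R ≤ 1 := by
  rw [← D.moment l]
  exact setIntegral_le_integral (D.moment_int l)
    (ae_of_all _ fun z => mul_nonneg (sq_nonneg _) (D.weight_nonneg z))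

lemma tendsto_setIntegral_closedBall {E : Type*} [NormedAddCommGroup E] [NormedSpace ℝ E]
    {F : ℂ → E} (hF : Integrable F) :
    Tendsto (fun R : ℝ => ∫ z in Metric.closedBall (0 : ℂ) R, F z) atTop (𝓝 (∫ z, F z)) :=
  (aecover_closedBall tendsto_id).integral_tendsto_of_countably_generated hF

lemma tendsto_discNorm (D : DiagonalKernel b ψ γ m A ρ) (l : ℕ) :
    Tendsto (fun R => discNorm γ m ρ l R) atTop (𝓝 1) := by
  rw [← D.moment l]
  exact tendsto_setIntegral_closedBall (D.moment_int l)

lemma summable_abs_coeff (D : DiagonalKernel b ψ γ m A ρ) (c : lp (fun _ : ℕ => ℂ) 2) (R : ℝ) :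
    Summable (fun l => ‖c l‖ * (|γ l| * |R| ^ m l)) := by
  refine (D.hasSum_series c (R : ℂ)).norm.congr fun l => ?_
  simp

lemma norm_term_le {z : ℂ} {R : ℝ} (hz : z ∈ Metric.closedBall (0 : ℂ) R) (l : ℕ) :
    ‖(γ l : ℂ) * z ^ m l‖ ≤ |γ l| * |R| ^ m l := by
  have hz' : ‖z‖ ≤ |R| := (by simpa using hz : ‖z‖ ≤ R).trans (le_abs_self R)
  simp only [norm_mul, Complex.norm_real, norm_pow, Real.norm_eq_abs]
  gcongr

/-- On a disc, pairing a series with a monomial picks out one coefficient. -/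
lemma integral_conj_mul_series (D : DiagonalKernel b ψ γ m A ρ) (c : lp (fun _ : ℕ => ℂ) 2)
    {f : ℂ → ℂ} (hf : ∀ z, HasSum (fun l => c l * ((γ l : ℂ) * z ^ m l)) (f z)) (l : ℕ) (R : ℝ) :
    ∫ z in Metric.closedBall (0 : ℂ) R, (γ l : ℂ) * conj z ^ m l * f z * (ρ z : ℂ)
      = c l * (discNorm γ m ρ l R : ℂ) := by
  set F : ℕ → ℂ → ℂ := fun k z =>
    (γ l : ℂ) * conj z ^ m l * (c k * ((γ k : ℂ) * z ^ m k)) * (ρ z : ℂ)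
  have hbound : ∀ k, ∀ z ∈ Metric.closedBall (0 : ℂ) R,
      ‖F k z‖ ≤ (|γ l| * |R| ^ m l) * (‖c k‖ * (|γ k| * |R| ^ m k)) * ρ z := by
    intro k z hz
    have h1 := norm_term_le (γ := γ) (m := m) hz k
    have h2 := norm_term_le (γ := γ) (m := m) (z := conj z) (R := R) (by simpa using hz) l
    simp only [F]
    rw [norm_mul, norm_mul, norm_mul (c k), Complex.norm_real, Real.norm_eq_abs,
      abs_of_nonneg (D.weight_nonneg z)]
    have := D.weight_nonneg z
    gcongr
  have hmeas : ∀ k, Measurable (F k) := by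
    intro k
    have := D.weight_meas
    simp only [F]
    fun_prop
  have hint : ∀ k, IntegrableOn (F k) (Metric.closedBall (0 : ℂ) R) := by
    intro k
    refine ((D.weight_loc R).const_mul
      ((|γ l| * |R| ^ m l) * (‖c k‖ * (|γ k| * |R| ^ m k)))).mono'
      (hmeas k).aestronglyMeasurable ?_
    exact (ae_restrict_iff' Metric.isClosed_closedBall.measurableSet).2
      (ae_of_all _ fun z hz => hbound k z hz)
  have hsum : Summable fun k => ∫ z in Metric.closedBall (0 : ℂ) R, ‖F k z‖ := by
    refine Summable.of_nonneg_of_le (fun k => integral_nonneg fun z => norm_nonneg _)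
      (fun k => ?_) (((D.summable_abs_coeff c R).mul_left (|γ l| * |R| ^ m l)).mul_right
        (∫ z in Metric.closedBall (0 : ℂ) R, ρ z))
    rw [← integral_const_mul]
    exact setIntegral_mono_on (hint k).norm ((D.weight_loc R).const_mul _)
      Metric.isClosed_closedBall.measurableSet (hbound k)
  have h := hasSum_integral_of_summable_integral_norm hint hsum
  have hts : ∀ z, ∑' k, F k z = (γ l : ℂ) * conj z ^ m l * f z * (ρ z : ℂ) := fun z =>
    (((hf z).mul_left _).mul_right _).tsum_eq
  simp only [hts] at h
  refine h.unique ?_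
  have hoff : ∀ k, k ≠ l → ∫ z in Metric.closedBall (0 : ℂ) R, F k z = 0 := by
    intro k hk
    have h0 := integral_conj_pow_mul_pow D.weight_radial R
      (p := m l) (q := m k) (fun h => hk (D.injective_exp h).symm)
    have : ∀ z, F k z = ((γ l : ℂ) * c k * γ k) * (conj z ^ m l * z ^ m k * (ρ z : ℂ)) := by
      intro z; simp only [F]; ring
    simp only [this]
    rw [integral_const_mul, h0, mul_zero]
  suffices hl : ∫ z in Metric.closedBall (0 : ℂ) R, F l z = c l * (discNorm γ m ρ l R : ℂ) by
    rw [← hl]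
    exact hasSum_single l hoff
  unfold discNorm
  rw [← integral_complex_ofReal, ← integral_const_mul]
  refine integral_congr_ae (ae_of_all _ fun z => ?_)
  simp only [F]
  have : conj z ^ m l * z ^ m l = ((‖z‖ : ℂ) ^ m l) ^ 2 := by
    rw [← mul_pow, Complex.conj_mul', ← pow_mul, ← pow_mul, mul_comm]
  push_cast
  linear_combination ((γ l : ℂ) ^ 2 * c l * ρ z) * this

lemma norm_series_le (D : DiagonalKernel b ψ γ m A ρ) (c : lp (fun _ : ℕ => ℂ) 2)
    {f : ℂ → ℂ} (hf : ∀ z, HasSum (fun l => c l * ((γ l : ℂ) * z ^ m l)) (f z)) {R : ℝ} {z : ℂ}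
    (hz : z ∈ Metric.closedBall (0 : ℂ) R) :
    ‖f z‖ ≤ ∑' l, ‖c l‖ * (|γ l| * |R| ^ m l) := by
  rw [← (hf z).tsum_eq]
  refine tsum_of_norm_bounded (D.summable_abs_coeff c R).hasSum fun l => ?_
  rw [norm_mul]
  gcongr
  exact norm_term_le hz l

lemma measurable_series {c : ℕ → ℂ}
    {f : ℂ → ℂ} (hf : ∀ z, HasSum (fun l => c l * ((γ l : ℂ) * z ^ m l)) (f z)) :
    Measurable f :=
  Measurable.of_hasSum (f := fun l z => c l * ((γ l : ℂ) * z ^ m l)) (fun l => by fun_prop) hf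

lemma summable_abs_kernel (D : DiagonalKernel b ψ γ m A ρ) (x R : ℝ) :
    Summable (fun l => (|γ l| * |R| ^ m l) * |ψ l x|) := by
  refine (D.kernel (R : ℂ) x).summable.norm.congr fun l => ?_
  simp

lemma norm_kernel_le (D : DiagonalKernel b ψ γ m A ρ) (x : ℝ) {R : ℝ} {z : ℂ}
    (hz : z ∈ Metric.closedBall (0 : ℂ) R) :
    ‖A z x‖ ≤ ∑' l, (|γ l| * |R| ^ m l) * |ψ l x| := by
  rw [← (D.kernel z x).tsum_eq]
  refine tsum_of_norm_bounded (D.summable_abs_kernel x R).hasSum fun l => ?_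
  rw [norm_mul, Complex.norm_real, Real.norm_eq_abs]
  gcongr
  exact norm_term_le hz l

lemma measurable_kernel (D : DiagonalKernel b ψ γ m A ρ) (x : ℝ) : Measurable fun z => A z x :=
  Measurable.of_hasSum (f := fun l z => (γ l : ℂ) * z ^ m l * (ψ l x : ℂ))
    (fun l => by fun_prop) (fun z => D.kernel z x)

lemma integrableOn_inv (D : DiagonalKernel b ψ γ m A ρ) (c : lp (fun _ : ℕ => ℂ) 2)
    {f : ℂ → ℂ} (hf : ∀ z, HasSum (fun l => c l * ((γ l : ℂ) * z ^ m l)) (f z)) (R x : ℝ) :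
    IntegrableOn (fun z => A (conj z) x * f z * (ρ z : ℂ)) (Metric.closedBall (0 : ℂ) R) := by
  have hA := (D.measurable_kernel x).comp (Complex.continuous_conj.measurable)
  have hfm := measurable_series hf
  have hρ := D.weight_meas
  refine ((D.weight_loc R).const_mul ((∑' l, (|γ l| * |R| ^ m l) * |ψ l x|) *
    (∑' l, ‖c l‖ * (|γ l| * |R| ^ m l)))).mono' ?_ ?_
  · exact ((hA.mul hfm).mul (Complex.measurable_ofReal.comp hρ)).aestronglyMeasurable
  · refine (ae_restrict_iff' Metric.isClosed_closedBall.measurableSet).2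
      (ae_of_all _ fun z hz => ?_)
    rw [norm_mul, norm_mul, Complex.norm_real, Real.norm_eq_abs,
      abs_of_nonneg (D.weight_nonneg z)]
    have h0 := D.weight_nonneg z
    have h1 := D.norm_kernel_le x (z := conj z) (R := R) (by simpa using hz)
    have h2 := D.norm_series_le c hf hz
    have h3 : 0 ≤ ∑' l, (|γ l| * |R| ^ m l) * |ψ l x| := tsum_nonneg fun l => by positivity
    gcongr

/-- The inversion integral over a disc, expanded in the basis functions. -/
lemma hasSum_disc_integral (D : DiagonalKernel b ψ γ m A ρ) (c : lp (fun _ : ℕ => ℂ) 2)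
    {f : ℂ → ℂ} (hf : ∀ z, HasSum (fun l => c l * ((γ l : ℂ) * z ^ m l)) (f z)) (R x : ℝ) :
    HasSum (fun l => (c l * (discNorm γ m ρ l R : ℂ)) * (ψ l x : ℂ))
      (∫ z in Metric.closedBall (0 : ℂ) R, A (conj z) x * f z * (ρ z : ℂ)) := by
  set M := ∑' l, ‖c l‖ * (|γ l| * |R| ^ m l)
  set F : ℕ → ℂ → ℂ := fun k z =>
    ((γ k : ℂ) * conj z ^ m k * (ψ k x : ℂ)) * f z * (ρ z : ℂ)
  have hbound : ∀ k, ∀ z ∈ Metric.closedBall (0 : ℂ) R,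
      ‖F k z‖ ≤ ((|γ k| * |R| ^ m k) * |ψ k x|) * M * ρ z := by
    intro k z hz
    have h1 := norm_term_le (γ := γ) (m := m) (z := conj z) (R := R) (by simpa using hz) k
    have h2 := D.norm_series_le c hf hz
    have := D.weight_nonneg z
    simp only [F]
    rw [norm_mul, norm_mul, norm_mul _ (ψ k x : ℂ), Complex.norm_real, Complex.norm_real,
      Real.norm_eq_abs, Real.norm_eq_abs, abs_of_nonneg this]
    gcongr
  have hmeas : ∀ k, Measurable (F k) := by
    intro k
    have := D.weight_meas
    have := measurable_series hf
    simp only [F]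
    fun_prop
  have hint : ∀ k, IntegrableOn (F k) (Metric.closedBall (0 : ℂ) R) := by
    intro k
    refine ((D.weight_loc R).const_mul (((|γ k| * |R| ^ m k) * |ψ k x|) * M)).mono'
      (hmeas k).aestronglyMeasurable ?_
    exact (ae_restrict_iff' Metric.isClosed_closedBall.measurableSet).2
      (ae_of_all _ fun z hz => hbound k z hz)
  have hsum : Summable fun k => ∫ z in Metric.closedBall (0 : ℂ) R, ‖F k z‖ := by
    refine Summable.of_nonneg_of_le (fun k => integral_nonneg fun z => norm_nonneg _)
      (fun k => ?_) (((D.summable_abs_kernel x R).mul_right M).mul_right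
        (∫ z in Metric.closedBall (0 : ℂ) R, ρ z))
    rw [← integral_const_mul]
    exact setIntegral_mono_on (hint k).norm ((D.weight_loc R).const_mul _)
      Metric.isClosed_closedBall.measurableSet (hbound k)
  have h := hasSum_integral_of_summable_integral_norm hint hsum
  have hts : ∀ z, ∑' k, F k z = A (conj z) x * f z * (ρ z : ℂ) := fun z =>
    (((D.kernel (conj z) x).mul_right _).mul_right _).tsum_eq
  simp only [hts] at h
  have he : ∀ l, ∫ z in Metric.closedBall (0 : ℂ) R, F l z
      = (c l * (discNorm γ m ρ l R : ℂ)) * (ψ l x : ℂ) := by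
    intro l
    rw [← D.integral_conj_mul_series c hf l R, ← integral_mul_const]
    refine integral_congr_ae (ae_of_all _ fun z => ?_)
    simp only [F]
    ring
  simpa only [he] using h

/-- The coefficients of a series truncated to the disc of radius `R`. -/
noncomputable def truncCoeff (D : DiagonalKernel b ψ γ m A ρ) (c : lp (fun _ : ℕ => ℂ) 2) (R : ℝ) :
    lp (fun _ : ℕ => ℂ) 2 :=
  ⟨fun l => c l * (discNorm γ m ρ l R : ℂ), by
    refine (lp.memℓp c).mono' fun l => ?_
    rw [norm_mul, Complex.norm_real, Real.norm_eq_abs, abs_of_nonneg (D.discNorm_nonneg l R)]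
    exact mul_le_of_le_one_right (norm_nonneg _) (D.discNorm_le_one l R)⟩

lemma disc_integral_ae (D : DiagonalKernel b ψ γ m A ρ) (c : lp (fun _ : ℕ => ℂ) 2)
    {f : ℂ → ℂ} (hf : ∀ z, HasSum (fun l => c l * ((γ l : ℂ) * z ^ m l)) (f z)) (R : ℝ) :
    (b.repr.symm (D.truncCoeff c R) : ℝ → ℂ) =ᵐ[volume]
      fun x => ∫ z in Metric.closedBall (0 : ℂ) R, A (conj z) x * f z * (ρ z : ℂ) :=
  repr_symm_ae_eq D.basis_ae _ fun x => D.hasSum_disc_integral c hf R x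

lemma tendsto_truncCoeff (D : DiagonalKernel b ψ γ m A ρ) (c : lp (fun _ : ℕ => ℂ) 2) :
    Tendsto (fun R => D.truncCoeff c R) atTop (𝓝 c) := by
  rw [tendsto_iff_norm_sub_tendsto_zero]
  have hsq : Tendsto (fun R => ‖D.truncCoeff c R - c‖ ^ 2) atTop (𝓝 0) := by
    have h1 : ∀ R, ‖D.truncCoeff c R - c‖ ^ 2
        = ∑' l, ‖c l‖ ^ 2 * (1 - discNorm γ m ρ l R) ^ 2 := by
      intro R
      have := lp.norm_rpow_eq_tsum (p := 2) (by norm_num) (D.truncCoeff c R - c)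
      simp only [ENNReal.toReal_ofNat, Real.rpow_ofNat] at this
      rw [this]
      congr 1 with l
      have : (D.truncCoeff c R - c) l = c l * ((discNorm γ m ρ l R - 1 : ℝ) : ℂ) := by
        change c l * (discNorm γ m ρ l R : ℂ) - c l = _
        push_cast; ring
      rw [this, norm_mul, Complex.norm_real, mul_pow, Real.norm_eq_abs, sq_abs]
      ring
    simp only [h1]
    have hc : Summable fun l => ‖c l‖ ^ 2 := by
      have := (lp.memℓp c).summable (by norm_num)
      simpa using this
    have h2 := tendsto_tsum_of_dominated_convergence (𝓕 := atTop)
      (f := fun R l => ‖c l‖ ^ 2 * (1 - discNorm γ m ρ l R) ^ 2) (g := fun _ => (0 : ℝ)) hc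
      (fun l => by
        have := ((D.tendsto_discNorm l).const_sub 1).pow 2
        simpa using this.const_mul (‖c l‖ ^ 2))
      (Eventually.of_forall fun R l => by
        have h0 := D.discNorm_nonneg l R
        have h1 := D.discNorm_le_one l R
        rw [Real.norm_eq_abs, abs_of_nonneg (by positivity)]
        refine mul_le_of_le_one_right (by positivity) ?_
        exact pow_le_one₀ (by linarith) (by linarith))
    simpa using h2
  have := hsq.sqrt
  simpa using this

/-- Summation of a square-summable series of normalized monomials, as a linear bijection. -/
noncomputable def seriesEquiv (D : DiagonalKernel b ψ γ m A ρ) :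
    lp (fun _ : ℕ => ℂ) 2 ≃ₗ[ℂ] l2Series (fun l z => (γ l : ℂ) * z ^ m l) :=
  LinearEquiv.ofBijective
    { toFun := fun c => ⟨fun z => ∑' l, c l * ((γ l : ℂ) * z ^ m l),
        c, lp.memℓp c, fun z => (D.hasSum_series c z).hasSum⟩
      map_add' := fun c d => by
        ext z
        change ∑' l, (c l + d l) * ((γ l : ℂ) * z ^ m l) = _
        simp only [add_mul]
        exact (D.hasSum_series c z).tsum_add (D.hasSum_series d z)
      map_smul' := fun a c => by
        ext z
        change ∑' l, (a * c l) * ((γ l : ℂ) * z ^ m l)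
          = a * ∑' l, c l * ((γ l : ℂ) * z ^ m l)
        simp only [mul_assoc]
        exact tsum_mul_left }
    (by
      constructor
      · rw [← LinearMap.ker_eq_bot, LinearMap.ker_eq_bot']
        intro c hc
        have h0 : ∀ z, HasSum (fun l => c l * ((γ l : ℂ) * z ^ m l)) 0 := by
          intro z
          have : ∑' l, c l * ((γ l : ℂ) * z ^ m l) = 0 := congrFun (congrArg Subtype.val hc) z
          rw [← this]
          exact (D.hasSum_series c z).hasSum
        ext l
        have h1 : ∀ R, c l * (discNorm γ m ρ l R : ℂ) = 0 := by
          intro R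
          rw [← D.integral_conj_mul_series c (f := fun _ => 0) h0 l R]
          simp
        have h2 : Tendsto (fun R => c l * (discNorm γ m ρ l R : ℂ)) atTop (𝓝 (c l * (1 : ℝ))) :=
          ((Complex.continuous_ofReal.tendsto _).comp (D.tendsto_discNorm l)).const_mul _
        simp only [h1] at h2
        have := tendsto_nhds_unique h2 tendsto_const_nhds
        simpa using this
      · rintro ⟨f, c, hc, hf⟩
        refine ⟨⟨c, hc⟩, ?_⟩
        ext z
        exact (hf z).tsum_eq)

lemma hasSum_seriesEquiv (D : DiagonalKernel b ψ γ m A ρ) (c : lp (fun _ : ℕ => ℂ) 2) (z : ℂ) :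
    HasSum (fun l => c l * ((γ l : ℂ) * z ^ m l)) ((D.seriesEquiv c : ℂ → ℂ) z) :=
  (D.hasSum_series c z).hasSum

/-- The transform with kernel `A` is inverted, in the mean and wherever the integral converges
absolutely, by the adjoint kernel. -/
theorem inversion (D : DiagonalKernel b ψ γ m A ρ) :
    ∃ T : H ≃ₗ[ℂ] l2Series (fun l z => (γ l : ℂ) * z ^ m l),
      (∀ (f : H) (z : ℂ), Integrable (fun x : ℝ => A z x * f x) ∧
        (T f : ℂ → ℂ) z = ∫ x : ℝ, A z x * f x) ∧
      (∀ f : l2Series (fun l z => (γ l : ℂ) * z ^ m l),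
        (∀ (R : ℝ) (x : ℝ),
          IntegrableOn (fun z => A (conj z) x * (f : ℂ → ℂ) z * (ρ z : ℂ))
            (Metric.closedBall (0 : ℂ) R)) ∧
        (∀ R : ℝ, MemLp (fun x : ℝ => ∫ z in Metric.closedBall (0 : ℂ) R,
          A (conj z) x * (f : ℂ → ℂ) z * (ρ z : ℂ)) 2 volume) ∧
        Tendsto (fun R : ℝ => eLpNorm (fun x : ℝ =>
          (∫ z in Metric.closedBall (0 : ℂ) R, A (conj z) x * (f : ℂ → ℂ) z * (ρ z : ℂ))
            - T.symm f x) 2 volume) atTop (𝓝 0)) ∧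
      (∀ f : l2Series (fun l z => (γ l : ℂ) * z ^ m l), ∀ᵐ x : ℝ,
        Integrable (fun z => A (conj z) x * (f : ℂ → ℂ) z * (ρ z : ℂ)) →
        T.symm f x = ∫ z : ℂ, A (conj z) x * (f : ℂ → ℂ) z * (ρ z : ℂ)) ∧
      (∀ f ∈ Submodule.span ℂ (Set.range fun l : ℕ => fun z : ℂ => z ^ m l),
        f ∈ l2Series (fun l z => (γ l : ℂ) * z ^ m l) ∧
        ∀ x : ℝ, Integrable (fun z => A (conj z) x * f z * (ρ z : ℂ))) := by
  refine ⟨b.repr.toLinearEquiv.trans D.seriesEquiv, ?_, ?_, ?_, ?_⟩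
  · intro f z
    refine ⟨D.integrable_kernel_mul f z, ?_⟩
    exact (D.hasSum_seriesEquiv (b.repr f) z).unique (D.hasSum_transform f z)
  · intro f
    obtain ⟨c, rfl⟩ := D.seriesEquiv.surjective f
    have hf := D.hasSum_seriesEquiv c
    refine ⟨D.integrableOn_inv c hf, fun R => ?_, ?_⟩
    · exact (Lp.memLp (b.repr.symm (D.truncCoeff c R))).ae_eq (D.disc_integral_ae c hf R)
    · have hT : (b.repr.toLinearEquiv.trans D.seriesEquiv).symm (D.seriesEquiv c)
          = b.repr.symm c := by
        rw [LinearEquiv.symm_apply_eq]; simp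
      rw [hT]
      have h1 : Tendsto (fun R => b.repr.symm (D.truncCoeff c R)) atTop (𝓝 (b.repr.symm c)) :=
        (b.repr.symm.continuous.tendsto _).comp (D.tendsto_truncCoeff c)
      refine ((Lp.tendsto_Lp_iff_tendsto_eLpNorm' _ _).mp h1).congr fun R => ?_
      refine eLpNorm_congr_ae ?_
      filter_upwards [D.disc_integral_ae c hf R] with x hx
      rw [Pi.sub_apply, hx]
  · intro f
    obtain ⟨c, rfl⟩ := D.seriesEquiv.surjective f
    have hf := D.hasSum_seriesEquiv c
    have hT : (b.repr.toLinearEquiv.trans D.seriesEquiv).symm (D.seriesEquiv c)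
        = b.repr.symm c := by
      rw [LinearEquiv.symm_apply_eq]; simp
    rw [hT]
    have h1 : Tendsto (fun R : ℕ => b.repr.symm (D.truncCoeff c R)) atTop
        (𝓝 (b.repr.symm c)) :=
      (b.repr.symm.continuous.tendsto _).comp
        ((D.tendsto_truncCoeff c).comp tendsto_natCast_atTop_atTop)
    obtain ⟨ns, hns, h2⟩ := (tendstoInMeasure_of_tendsto_Lp h1).exists_seq_tendsto_ae
    have h3 : ∀ᵐ x : ℝ, ∀ R : ℕ, (b.repr.symm (D.truncCoeff c R) : ℝ → ℂ) x =
        ∫ z in Metric.closedBall (0 : ℂ) R,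
          A (conj z) x * (D.seriesEquiv c : ℂ → ℂ) z * (ρ z : ℂ) :=
      ae_all_iff.2 fun R => D.disc_integral_ae c hf R
    filter_upwards [h2, h3] with x hx hx' hint
    refine tendsto_nhds_unique hx ?_
    simp only [hx']
    exact (tendsto_setIntegral_closedBall hint).comp
      (tendsto_natCast_atTop_atTop.comp hns.tendsto_atTop)
  · intro f hf
    induction hf using Submodule.span_induction with
    | mem f hf =>
      obtain ⟨l, rfl⟩ := hf
      refine ⟨?_, D.decay l⟩
      refine ⟨Pi.single l ((γ l : ℂ)⁻¹), ?_, fun z => ?_⟩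
      · exact (lp.single (E := fun _ : ℕ => ℂ) 2 l ((γ l : ℂ)⁻¹)).2
      · convert hasSum_single l (fun k hk => ?_) using 1
        · have : (γ l : ℂ) ≠ 0 := by exact_mod_cast D.coeff_ne l
          simp only [Pi.single_eq_same]
          field_simp
        · simp [Pi.single_eq_of_ne hk]
    | zero => exact ⟨Submodule.zero_mem _, fun x => by simp⟩
    | add f g _ _ hf hg =>
      refine ⟨Submodule.add_mem _ hf.1 hg.1, fun x => ?_⟩
      refine ((hf.2 x).add (hg.2 x)).congr (ae_of_all _ fun z => ?_)
      simp only [Pi.add_apply]; ring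
    | smul a f _ hf =>
      refine ⟨Submodule.smul_mem _ a hf.1, fun x => ?_⟩
      refine ((hf.2 x).const_mul a).congr (ae_of_all _ fun z => ?_)
      simp only [Pi.smul_apply, smul_eq_mul]; ring

end DiagonalKernel

/-! ### Power series with reciprocal Gamma coefficients -/

lemma summable_pow_div_Gamma {c : ℝ} (hc : 0 < c) (B : ℝ) :
    Summable fun l : ℕ => B ^ l / Real.Gamma (l + c) := by
  rcases eq_or_ne B 0 with rfl | hB
  · exact summable_of_ne_finset_zero (s := {0}) fun l hl => by
      simp at hl; simp [hl]
  have hG : ∀ l : ℕ, 0 < Real.Gamma (l + c) := fun l => Real.Gamma_pos_of_pos (by positivity)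
  refine summable_of_ratio_test_tendsto_lt_one (l := 0) (by norm_num)
    (Eventually.of_forall fun l => div_ne_zero (pow_ne_zero _ hB) (hG l).ne') ?_
  have h1 : ∀ l : ℕ, ‖B ^ (l + 1) / Real.Gamma ((l + 1 : ℕ) + c)‖ / ‖B ^ l / Real.Gamma (l + c)‖
      = |B| / (l + c) := by
    intro l
    have h2 : Real.Gamma ((l + 1 : ℕ) + c) = (l + c) * Real.Gamma (l + c) := by
      rw [← Real.Gamma_add_one (by positivity)]; congr 1; push_cast; ring
    have h3 := hG l
    have h4 : 0 < (l : ℝ) + c := by positivity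
    have h5 : |B| ≠ 0 := abs_ne_zero.2 hB
    rw [h2, norm_div, norm_div, norm_pow, norm_pow, norm_mul, Real.norm_eq_abs, Real.norm_eq_abs,
      Real.norm_eq_abs, abs_of_pos h3, abs_of_pos h4, pow_succ]
    field_simp
  simp only [h1]
  exact Tendsto.const_div_atTop
    (tendsto_atTop_add_const_right _ _ tendsto_natCast_atTop_atTop) _

/-- The entire function `∑ w ^ l / (Γ(l + c) l!)`; up to a power, the modified Bessel function
`I_{c-1}` in the variable `w = x² / 4`. -/
noncomputable def besselV (c w : ℝ) : ℝ := ∑' l : ℕ, w ^ l / (Real.Gamma (l + c) * l.factorial)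

lemma one_le_factorial_real (l : ℕ) : (1 : ℝ) ≤ l.factorial := by
  exact_mod_cast Nat.one_le_iff_ne_zero.2 l.factorial_ne_zero

lemma summable_besselV {c : ℝ} (hc : 0 < c) (w : ℝ) :
    Summable fun l : ℕ => w ^ l / (Real.Gamma (l + c) * l.factorial) := by
  refine Summable.of_norm_bounded (summable_pow_div_Gamma hc |w|) fun l => ?_
  have hG : 0 < Real.Gamma (l + c) := Real.Gamma_pos_of_pos (by positivity)
  have h1 := one_le_factorial_real l
  rw [norm_div, norm_pow, Real.norm_eq_abs, Real.norm_eq_abs,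
    abs_of_pos (by positivity : 0 < Real.Gamma (l + c) * l.factorial)]
  gcongr
  exact le_mul_of_one_le_right hG.le h1

lemma besselV_zero (c : ℝ) : besselV c 0 = 1 / Real.Gamma c := by
  rw [besselV, tsum_eq_single 0 (fun l hl => by simp [hl])]
  simp

lemma besselV_pos {c : ℝ} (hc : 0 < c) {w : ℝ} (hw : 0 ≤ w) : 0 < besselV c w := by
  have hG : ∀ l : ℕ, 0 < Real.Gamma (l + c) := fun l => Real.Gamma_pos_of_pos (by positivity)
  refine (summable_besselV hc w).tsum_pos (fun l => ?_) 0 ?_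
  · have := hG l; positivity
  · have := hG 0; simp only [pow_zero]; positivity

lemma hasDerivAt_besselV {c : ℝ} (hc : 0 < c) (w : ℝ) :
    HasDerivAt (besselV c) (besselV (c + 1) w) w := by
  set r : ℝ := |w| + 1
  have hr : 1 ≤ r := by simp [r]
  have hG : ∀ l : ℕ, 0 < Real.Gamma (l + c) := fun l => Real.Gamma_pos_of_pos (by positivity)
  have h := hasDerivAt_tsum_of_isPreconnected
    (g := fun (l : ℕ) (y : ℝ) => y ^ l / (Real.Gamma (l + c) * l.factorial))
    (g' := fun l y => (l * y ^ (l - 1)) / (Real.Gamma (l + c) * l.factorial))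
    (summable_pow_div_Gamma hc r) (t := Metric.ball 0 r) Metric.isOpen_ball
    (convex_ball 0 r).isPreconnected
    (fun l y _ => (hasDerivAt_pow l y).div_const _)
    (fun l y hy => ?_) (y₀ := 0) (by simp; linarith) (summable_besselV hc 0) (y := w)
    (by simp [r])
  · refine h.congr_deriv ?_
    unfold besselV
    rw [Summable.tsum_eq_zero_add]
    · simp only [Nat.cast_zero, zero_mul, zero_div, zero_add]
      congr 1 with l
      have e : ((l + 1 : ℕ) : ℝ) + c = l + (c + 1) := by push_cast; ring
      have h1 : 0 < Real.Gamma (l + (c + 1)) := Real.Gamma_pos_of_pos (by positivity)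
      rw [e, Nat.add_sub_cancel, Nat.factorial_succ]
      push_cast
      field_simp
    · refine (summable_nat_add_iff 1).1 ?_
      refine (summable_besselV (c := c + 1) (by positivity) w).congr fun l => ?_
      have e : ((l + 1 : ℕ) : ℝ) + c = l + (c + 1) := by push_cast; ring
      have h1 : 0 < Real.Gamma (l + (c + 1)) := Real.Gamma_pos_of_pos (by positivity)
      rw [e, Nat.add_sub_cancel, Nat.factorial_succ]
      push_cast
      field_simp
  · have hy' : |y| ≤ r := by
      have := mem_ball_zero_iff.1 hy; rw [Real.norm_eq_abs] at this; exact this.le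
    have h1 : (l : ℝ) ≤ l.factorial := by exact_mod_cast Nat.self_le_factorial l
    have h2 := hG l
    have h3 : (0 : ℝ) < l.factorial := by positivity
    rw [norm_div, norm_mul, norm_pow, Real.norm_eq_abs, Real.norm_eq_abs, Real.norm_eq_abs,
      abs_of_pos (by positivity : 0 < Real.Gamma (l + c) * l.factorial), Nat.abs_cast]
    rw [div_le_div_iff₀ (by positivity) h2]
    have h4 : |y| ^ (l - 1) ≤ r ^ l :=
      (pow_le_pow_left₀ (abs_nonneg _) hy' _).trans (pow_le_pow_right₀ hr (Nat.sub_le _ _))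
    calc (l : ℝ) * |y| ^ (l - 1) * Real.Gamma (l + c)
        ≤ l.factorial * r ^ l * Real.Gamma (l + c) := by gcongr
      _ = _ := by ring

/-- The recurrence of the Bessel functions in the order. -/
lemma besselV_contiguous {c : ℝ} (hc : 0 < c) (w : ℝ) :
    c * besselV (c + 1) w + w * besselV (c + 2) w = besselV c w := by
  have hs : (Summable fun l : ℕ => l * (w ^ l / (Real.Gamma (l + (c + 1)) * l.factorial))) ∧
      ∑' l : ℕ, l * (w ^ l / (Real.Gamma (l + (c + 1)) * l.factorial))
        = w * besselV (c + 2) w := by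
    have e : ∀ l : ℕ, ((l + 1 : ℕ) : ℝ) *
        (w ^ (l + 1) / (Real.Gamma ((l + 1 : ℕ) + (c + 1)) * (l + 1).factorial))
        = w * (w ^ l / (Real.Gamma (l + (c + 2)) * l.factorial)) := by
      intro l
      have e : ((l + 1 : ℕ) : ℝ) + (c + 1) = l + (c + 2) := by push_cast; ring
      have h1 : 0 < Real.Gamma (l + (c + 2)) := Real.Gamma_pos_of_pos (by positivity)
      rw [e, Nat.factorial_succ, pow_succ]
      push_cast
      field_simp
    have h1 : Summable fun l : ℕ =>
        l * (w ^ l / (Real.Gamma (l + (c + 1)) * l.factorial)) := by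
      refine (summable_nat_add_iff 1).1 ?_
      simp only [e]
      exact (summable_besselV (by positivity) w).mul_left w
    refine ⟨h1, ?_⟩
    rw [h1.tsum_eq_zero_add]
    simp only [e]
    rw [tsum_mul_left, besselV]; simp
  rw [← hs.2, besselV, besselV, ← tsum_mul_left,
    ← ((summable_besselV (by positivity) w).mul_left c).tsum_add hs.1]
  congr 1 with l
  have h2 : Real.Gamma (l + (c + 1)) = (l + c) * Real.Gamma (l + c) := by
    rw [← Real.Gamma_add_one (by positivity)]; congr 1; ring
  have h3 : 0 < Real.Gamma (l + c) := Real.Gamma_pos_of_pos (by positivity)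
  rw [h2]
  field_simp
  ring

lemma hasDerivAt_rpow_mul_besselV {μ : ℝ} (hμ : 0 < μ) {w : ℝ} (hw : 0 < w) :
    HasDerivAt (fun w => w ^ μ * besselV (1 + μ) w) (w ^ (μ - 1) * besselV μ w) w := by
  have h := (Real.hasDerivAt_rpow_const (p := μ) (Or.inl hw.ne')).mul
    (hasDerivAt_besselV (c := 1 + μ) (by positivity) w)
  refine h.congr_deriv ?_
  rw [← besselV_contiguous hμ, show (1 + μ + 1) = μ + 2 by ring, add_comm 1 μ,
    show w ^ μ = w ^ (μ - 1) * w by rw [← Real.rpow_add_one hw.ne']; congr 1; ring]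
  ring

/-! ### The integral representation of `K_μ` -/

/-- The integral `∫₀^∞ e^(-t - w/t) t^(μ-1) dt`; up to a power, the Bessel function `K_μ` in the
variable `w = x² / 4`. -/
noncomputable def besselInt (μ w : ℝ) : ℝ :=
  ∫ t in Set.Ioi (0 : ℝ), Real.exp (-t - w / t) * t ^ (μ - 1)

lemma aestronglyMeasurable_besselInt (a w : ℝ) :
    AEStronglyMeasurable (fun t : ℝ => Real.exp (-t - w / t) * t ^ a)
      (volume.restrict (Set.Ioi 0)) := by
  have : Measurable (fun t : ℝ => Real.exp (-t - w / t) * t ^ a) := by fun_prop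
  exact this.aestronglyMeasurable

lemma integrableOn_besselInt {μ w : ℝ} (hμ : 0 < μ) (hw : 0 ≤ w) :
    IntegrableOn (fun t : ℝ => Real.exp (-t - w / t) * t ^ (μ - 1)) (Set.Ioi 0) := by
  refine (Real.GammaIntegral_convergent hμ).mono' (aestronglyMeasurable_besselInt _ _) ?_
  refine (ae_restrict_iff' measurableSet_Ioi).2 (ae_of_all _ fun t ht => ?_)
  have ht : 0 < t := ht
  rw [Real.norm_eq_abs, abs_of_pos (by positivity)]
  gcongr
  have : 0 ≤ w / t := by positivity
  linarith

lemma besselInt_nonneg (μ w : ℝ) : 0 ≤ besselInt μ w :=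
  setIntegral_nonneg measurableSet_Ioi fun t ht => by
    have : (0 : ℝ) < t := ht
    positivity

/-- The substitution `t ↦ w / t`. -/
lemma integral_besselInt_subst {μ w : ℝ} (hw : 0 < w) :
    ∫ t in Set.Ioi (0 : ℝ), Real.exp (-t - w / t) * t ^ (μ - 2) =
      w ^ (μ - 1) * besselInt (1 - μ) w := by
  rw [← integral_comp_rpow_Ioi (fun t => Real.exp (-t - w / t) * t ^ (μ - 2))
    (p := -1) (by norm_num)]
  have h := integral_comp_mul_left_Ioi
    (fun s => Real.exp (-s - w / s) * s ^ (1 - μ - 1)) 0 hw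
  rw [mul_zero] at h
  rw [besselInt, eq_comm, show w ^ (μ - 1) = w ^ μ * w⁻¹ by
    rw [Real.rpow_sub hw, Real.rpow_one, div_eq_mul_inv], mul_assoc]
  rw [smul_eq_mul] at h
  rw [← h, ← integral_const_mul]
  refine setIntegral_congr_fun measurableSet_Ioi fun x hx => ?_
  have hx : 0 < x := hx
  simp only [smul_eq_mul, abs_neg, abs_one, one_mul]
  rw [Real.mul_rpow hw.le hx.le, Real.rpow_neg_one, Real.inv_rpow hx.le,
    ← Real.rpow_neg hx.le]
  have e1 : -(w * x) - w / (w * x) = -x⁻¹ - w / x⁻¹ := by field_simp; ring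
  have e2 : x ^ ((-1 : ℝ) - 1) * x ^ (-(μ - 2)) = x ^ (1 - μ - 1) := by
    rw [← Real.rpow_add hx]; congr 1; ring
  have e3 : w ^ μ * w ^ (1 - μ - 1) = 1 := by
    rw [← Real.rpow_add hw]; simp
  rw [e1]
  linear_combination (Real.exp (-x⁻¹ - w / x⁻¹) * x ^ (1 - μ - 1)) * e3
    - Real.exp (-x⁻¹ - w / x⁻¹) * e2

lemma hasDerivAt_besselInt {μ w : ℝ} (hμ : 0 < μ) (hw : 0 < w) :
    HasDerivAt (besselInt μ) (-(w ^ (μ - 1) * besselInt (1 - μ) w)) w := by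
  have hbi : IntegrableOn (fun t : ℝ => (2 / w) * (Real.exp (-t) * t ^ (μ - 1))) (Set.Ioi 0) :=
    (Real.GammaIntegral_convergent hμ).const_mul _
  have h := hasDerivAt_integral_of_dominated_loc_of_deriv_le
    (μ := volume.restrict (Set.Ioi (0 : ℝ))) (x₀ := w)
    (F := fun w t => Real.exp (-t - w / t) * t ^ (μ - 1))
    (F' := fun w t => -(Real.exp (-t - w / t) * t ^ (μ - 2)))
    (bound := fun t => (2 / w) * (Real.exp (-t) * t ^ (μ - 1)))
    (s := Set.Ioi (w / 2)) (Ioi_mem_nhds (by linarith))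
    (Eventually.of_forall fun y => aestronglyMeasurable_besselInt _ _)
    (integrableOn_besselInt hμ hw.le) (aestronglyMeasurable_besselInt _ _).neg
    ?_ hbi ?_
  · refine h.2.congr_deriv ?_
    rw [integral_neg, integral_besselInt_subst hw]
  · refine (ae_restrict_iff' measurableSet_Ioi).2 (ae_of_all _ fun t ht y hy => ?_)
    have ht : 0 < t := ht
    have hy : w / 2 < y := hy
    have hy0 : 0 < y := by linarith
    rw [norm_neg, Real.norm_eq_abs, abs_of_pos (by positivity)]
    -- `e^(-y/t) ≤ t/y` trades the extra factor `1/t` for a constant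
    have h1 : Real.exp (-(y / t)) ≤ t / y := by
      rw [Real.exp_neg, ← inv_div y t]
      exact inv_anti₀ (by positivity) ((by linarith : y / t ≤ y / t + 1).trans
        (Real.add_one_le_exp _))
    have h2 : t / y ≤ 2 / w * t := by
      rw [div_mul_eq_mul_div, div_le_div_iff₀ hy0 hw]; nlinarith
    have h3 : t ^ (μ - 1) = t * t ^ (μ - 2) := by
      rw [mul_comm, ← Real.rpow_add_one ht.ne']; congr 1; ring
    rw [sub_eq_add_neg, Real.exp_add, h3]
    calc Real.exp (-t) * Real.exp (-(y / t)) * t ^ (μ - 2)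
        ≤ Real.exp (-t) * (2 / w * t) * t ^ (μ - 2) := by gcongr; exact h1.trans h2
      _ = _ := by ring
  · refine (ae_restrict_iff' measurableSet_Ioi).2 (ae_of_all _ fun t ht y _ => ?_)
    have ht : 0 < t := ht
    have h1 : HasDerivAt (fun y : ℝ => -t - y / t) (-(1 / t)) y :=
      ((hasDerivAt_id y).div_const t).const_sub (-t)
    refine (h1.exp.mul_const (t ^ (μ - 1))).congr_deriv ?_
    have h3 : t ^ (μ - 1) = t * t ^ (μ - 2) := by
      rw [mul_comm, ← Real.rpow_add_one ht.ne']; congr 1; ring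
    rw [h3]
    field_simp

lemma tendsto_besselInt {μ : ℝ} (hμ : 0 < μ) :
    Tendsto (besselInt μ) (𝓝[>] 0) (𝓝 (Real.Gamma μ)) := by
  rw [Real.Gamma_eq_integral hμ]
  refine tendsto_integral_filter_of_dominated_convergence
    (fun t => Real.exp (-t) * t ^ (μ - 1))
    (Eventually.of_forall fun y => aestronglyMeasurable_besselInt _ _) ?_
    (Real.GammaIntegral_convergent hμ) ?_
  · filter_upwards [self_mem_nhdsWithin] with w hw
    have hw : 0 < w := hw
    refine (ae_restrict_iff' measurableSet_Ioi).2 (ae_of_all _ fun t ht => ?_)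
    have ht : 0 < t := ht
    rw [Real.norm_eq_abs, abs_of_pos (by positivity)]
    gcongr
    have : 0 ≤ w / t := by positivity
    linarith
  · refine (ae_restrict_iff' measurableSet_Ioi).2 (ae_of_all _ fun t ht => ?_)
    have : Tendsto (fun w : ℝ => Real.exp (-t - w / t) * t ^ (μ - 1)) (𝓝 0)
        (𝓝 (Real.exp (-t - 0 / t) * t ^ (μ - 1))) := by
      apply Continuous.tendsto; fun_prop
    rw [zero_div, sub_zero] at this
    exact this.mono_left nhdsWithin_le_nhds

lemma eq_zero_of_hasDerivAt_zero_of_tendsto {f : ℝ → ℝ}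
    (hf : ∀ w, 0 < w → HasDerivAt f 0 w) (h0 : Tendsto f (𝓝[>] 0) (𝓝 0)) {w : ℝ} (hw : 0 < w) :
    f w = 0 := by
  have hconst : ∀ y ∈ Set.Ioi (0 : ℝ), f y = f w := fun y hy =>
    isOpen_Ioi.is_const_of_deriv_eq_zero isPreconnected_Ioi
      (fun y hy => (hf y hy).differentiableAt.differentiableWithinAt)
      (fun y hy => (hf y hy).deriv) hy hw
  refine tendsto_nhds_unique ((tendsto_congr' ?_).1 tendsto_const_nhds) h0
  filter_upwards [self_mem_nhdsWithin] with y hy using (hconst y hy).symm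

/-- The combination of the power series that equals `besselInt`. -/
noncomputable def besselSeries (μ w : ℝ) : ℝ :=
  Real.Gamma μ * Real.Gamma (1 - μ) * (besselV (1 - μ) w - w ^ μ * besselV (1 + μ) w)

lemma hasDerivAt_besselSeries {μ w : ℝ} (hμ : 0 < μ) (hμ1 : μ < 1) (hw : 0 < w) :
    HasDerivAt (besselSeries μ) (-(w ^ (μ - 1) * besselSeries (1 - μ) w)) w := by
  have h := ((hasDerivAt_besselV (c := 1 - μ) (by linarith) w).sub
    (hasDerivAt_rpow_mul_besselV hμ hw)).const_mul (Real.Gamma μ * Real.Gamma (1 - μ))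
  refine h.congr_deriv ?_
  have e : w ^ (μ - 1) * w ^ (1 - μ) = 1 := by rw [← Real.rpow_add hw]; simp
  unfold besselSeries
  rw [show 1 - (1 - μ) = μ by ring, show 1 + (1 - μ) = 1 - μ + 1 by ring]
  linear_combination (-(Real.Gamma μ * Real.Gamma (1 - μ) * besselV (1 - μ + 1) w)) * e

lemma tendsto_besselV {c : ℝ} (hc : 0 < c) :
    Tendsto (besselV c) (𝓝[>] 0) (𝓝 (1 / Real.Gamma c)) := by
  rw [← besselV_zero]
  exact (hasDerivAt_besselV hc 0).continuousAt.tendsto.mono_left nhdsWithin_le_nhds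

lemma tendsto_rpow_mul_besselV {μ : ℝ} (hμ : 0 < μ) :
    Tendsto (fun w => w ^ μ * besselV (1 + μ) w) (𝓝[>] 0) (𝓝 0) := by
  have h := ((Real.continuousAt_rpow_const 0 μ (Or.inr hμ.le)).tendsto.mono_left
    (nhdsWithin_le_nhds (s := Set.Ioi 0))).mul (tendsto_besselV (c := 1 + μ) (by positivity))
  simpa [Real.zero_rpow hμ.ne'] using h

lemma tendsto_besselSeries {μ : ℝ} (hμ : 0 < μ) (hμ1 : μ < 1) :
    Tendsto (besselSeries μ) (𝓝[>] 0) (𝓝 (Real.Gamma μ)) := by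
  have h := ((tendsto_besselV (c := 1 - μ) (by linarith)).sub
    (tendsto_rpow_mul_besselV hμ)).const_mul (Real.Gamma μ * Real.Gamma (1 - μ))
  have hG : 0 < Real.Gamma (1 - μ) := Real.Gamma_pos_of_pos (by linarith)
  rw [sub_zero, mul_assoc, mul_one_div_cancel hG.ne', mul_one] at h
  exact h

/-- Both sides, for the orders `μ` and `1 - μ` together, solve the first-order system
`f' = -w^(μ-1) g`, `g' = -w^(-μ) f` with the same limits at `0`. The difference `(f, g)` of two
solutions is compared with the positive solution `u = V(1-μ)`, `v = w^(1-μ) V(2-μ)` of the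
system with the opposite sign: the Wronskian `f v + g u` is constant, hence zero, so `f / u` is
constant, hence zero. -/
theorem besselInt_eq_besselSeries {μ w : ℝ} (hμ : 0 < μ) (hμ1 : μ < 1) (hw : 0 < w) :
    besselInt μ w = besselSeries μ w := by
  have hμ' : 0 < 1 - μ := by linarith
  set f : ℝ → ℝ := fun w => besselInt μ w - besselSeries μ w
  set g : ℝ → ℝ := fun w => besselInt (1 - μ) w - besselSeries (1 - μ) w
  set u : ℝ → ℝ := besselV (1 - μ)
  set v : ℝ → ℝ := fun w => w ^ (1 - μ) * besselV (1 + (1 - μ)) w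
  have hf : ∀ w, 0 < w → HasDerivAt f (-(w ^ (μ - 1) * g w)) w := fun w hw => by
    refine ((hasDerivAt_besselInt hμ hw).sub (hasDerivAt_besselSeries hμ hμ1 hw)).congr_deriv ?_
    simp only [g]; ring
  have hg : ∀ w, 0 < w → HasDerivAt g (-(w ^ (-μ) * f w)) w := fun w hw => by
    refine ((hasDerivAt_besselInt hμ' hw).sub
      (hasDerivAt_besselSeries hμ' (by linarith) hw)).congr_deriv ?_
    simp only [f]; rw [show 1 - μ - 1 = -μ by ring, show 1 - (1 - μ) = μ by ring]; ring
  have hu : ∀ w, 0 < w → HasDerivAt u (w ^ (μ - 1) * v w) w := fun w hw => by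
    refine (hasDerivAt_besselV hμ' w).congr_deriv ?_
    have e : w ^ (μ - 1) * w ^ (1 - μ) = 1 := by rw [← Real.rpow_add hw]; simp
    simp only [v]
    rw [← mul_assoc, e, one_mul, add_comm]
  have hv : ∀ w, 0 < w → HasDerivAt v (w ^ (-μ) * u w) w := fun w hw => by
    refine (hasDerivAt_rpow_mul_besselV hμ' hw).congr_deriv ?_
    rw [show 1 - μ - 1 = -μ by ring]
  have hf0 : Tendsto f (𝓝[>] 0) (𝓝 0) := by
    simpa using (tendsto_besselInt hμ).sub (tendsto_besselSeries hμ hμ1)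
  have hg0 : Tendsto g (𝓝[>] 0) (𝓝 0) := by
    simpa using (tendsto_besselInt hμ').sub (tendsto_besselSeries hμ' (by linarith))
  have hu0 : Tendsto u (𝓝[>] 0) (𝓝 (1 / Real.Gamma (1 - μ))) := tendsto_besselV hμ'
  have hv0 : Tendsto v (𝓝[>] 0) (𝓝 0) := tendsto_rpow_mul_besselV hμ'
  have hQ : ∀ w, 0 < w → f w * v w + g w * u w = 0 := fun w hw => by
    refine eq_zero_of_hasDerivAt_zero_of_tendsto (f := fun w => f w * v w + g w * u w)
      (fun w hw => ?_) ?_ hw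
    · refine (((hf w hw).mul (hv w hw)).add ((hg w hw).mul (hu w hw))).congr_deriv ?_
      ring
    · simpa using (hf0.mul hv0).add (hg0.mul hu0)
  have hfu : f w / u w = 0 := by
    refine eq_zero_of_hasDerivAt_zero_of_tendsto (f := fun w => f w / u w)
      (fun w hw => ?_) ?_ hw
    · refine ((hf w hw).div (hu w hw) (besselV_pos hμ' hw.le).ne').congr_deriv ?_
      rw [div_eq_zero_iff]
      left
      linear_combination (-(w ^ (μ - 1))) * hQ w hw
    · have hG : 1 / Real.Gamma (1 - μ) ≠ 0 :=
        (one_div_pos.2 (Real.Gamma_pos_of_pos hμ')).ne'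
      have := hf0.div hu0 hG
      rw [zero_div] at this
      exact this
  rcases div_eq_zero_iff.1 hfu with h | h
  · exact sub_eq_zero.1 h
  · exact absurd h (besselV_pos hμ' hw.le).ne'

lemma besselI_eq (ν x : ℝ) : besselI ν x = (x / 2) ^ ν * besselV (1 + ν) ((x / 2) ^ 2) := by
  rw [besselI, besselV]
  congr 2 with l
  rw [← pow_mul, show (l : ℝ) + (1 + ν) = l + ν + 1 by ring]
  ring

theorem besselK_eq {μ x : ℝ} (hμ : 0 < μ) (hμ1 : μ < 1) (hx : 0 < x) :
    besselK μ x = 1 / 2 * (x / 2) ^ (-μ) * besselInt μ ((x / 2) ^ 2) := by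
  rw [besselInt_eq_besselSeries hμ hμ1 (by positivity), besselSeries,
    Real.Gamma_mul_Gamma_one_sub, besselK, besselI_eq, besselI_eq]
  have hx2 : 0 < x / 2 := by positivity
  have e : (x / 2) ^ (-μ) * ((x / 2) ^ 2) ^ μ = (x / 2) ^ μ := by
    rw [← Real.rpow_natCast, ← Real.rpow_mul hx2.le, ← Real.rpow_add hx2]
    congr 1; push_cast; ring
  have hsin : 0 < Real.sin (Real.pi * μ) :=
    Real.sin_pos_of_pos_of_lt_pi (by positivity) (by nlinarith [Real.pi_pos])
  rw [mul_comm μ, ← sub_eq_add_neg]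
  rw [← e]
  field_simp

/-! ### Size and moments of `K_μ` -/

/-- A quarter of `t` in the exponent keeps the integral convergent; the rest of the exponent is at
least `(3/4) (t + y²/t) ≥ (3/2) y`. -/
lemma besselInt_le {μ y : ℝ} (hμ : 0 < μ) :
    besselInt μ (y ^ 2) ≤ (1 / (1 / 4)) ^ μ * Real.Gamma μ * Real.exp (-(3 / 2) * y) := by
  have h1 : ∫ t in Set.Ioi (0 : ℝ), Real.exp (-(3 / 2) * y) *
      (t ^ (μ - 1) * Real.exp (-((1 / 4) * t))) =
      (1 / (1 / 4)) ^ μ * Real.Gamma μ * Real.exp (-(3 / 2) * y) := by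
    rw [integral_const_mul, Real.integral_rpow_mul_exp_neg_mul_Ioi hμ (by norm_num)]; ring
  have hint : IntegrableOn (fun t : ℝ => Real.exp (-(3 / 2) * y) *
      (t ^ (μ - 1) * Real.exp (-((1 / 4) * t)))) (Set.Ioi 0) := by
    have := integrableOn_rpow_mul_exp_neg_mul_rpow (p := 1) (s := μ - 1) (b := 1 / 4)
      (by linarith) (by norm_num) (by norm_num)
    simp only [Real.rpow_one] at this
    refine (this.const_mul (Real.exp (-(3 / 2) * y))).congr (ae_of_all _ fun t => ?_)
    simp only [neg_mul]
  rw [← h1, besselInt]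
  refine setIntegral_mono_on (integrableOn_besselInt hμ (sq_nonneg y)) hint measurableSet_Ioi
    fun t ht => ?_
  have ht : 0 < t := ht
  rw [mul_comm (t ^ (μ - 1)), ← mul_assoc, ← Real.exp_add]
  gcongr
  have h2 : 2 * y ≤ t + y ^ 2 / t := by
    rw [← sub_nonneg]
    have : t + y ^ 2 / t - 2 * y = (t - y) ^ 2 / t := by field_simp; ring
    rw [this]; positivity
  have h3 : 0 ≤ y ^ 2 / t := by positivity
  linarith

/-- The Mellin transform of `besselInt`. -/
lemma besselInt_moment {μ q : ℝ} (hμ : 0 < μ) (hq : 0 < q) :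
    IntegrableOn (fun w => w ^ (q - 1) * besselInt μ w) (Set.Ioi 0) ∧
    ∫ w in Set.Ioi (0 : ℝ), w ^ (q - 1) * besselInt μ w
      = Real.Gamma q * Real.Gamma (q + μ) := by
  set F : ℝ × ℝ → ℝ := fun p => p.1 ^ (q - 1) * (Real.exp (-p.2 - p.1 / p.2) * p.2 ^ (μ - 1))
  have hinner : ∀ t : ℝ, 0 < t → ∀ w : ℝ,
      F (w, t) = (Real.exp (-t) * t ^ (μ - 1)) * (w ^ (q - 1) * Real.exp (-((1 / t) * w))) := by
    intro t ht w
    simp only [F]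
    rw [show -t - w / t = -t + -((1 / t) * w) by ring, Real.exp_add]
    ring
  have hval : ∀ t : ℝ, 0 < t → ∫ w in Set.Ioi (0 : ℝ), F (w, t)
      = Real.Gamma q * (Real.exp (-t) * t ^ (q + μ - 1)) := by
    intro t ht
    simp only [hinner t ht]
    rw [integral_const_mul, Real.integral_rpow_mul_exp_neg_mul_Ioi hq (by positivity)]
    rw [one_div_one_div, show q + μ - 1 = (μ - 1) + q by ring, Real.rpow_add ht]
    ring
  have hmeas : Measurable F := by fun_prop
  have hint : Integrable F ((volume.restrict (Set.Ioi (0 : ℝ))).prod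
      (volume.restrict (Set.Ioi (0 : ℝ)))) := by
    rw [integrable_prod_iff' hmeas.aestronglyMeasurable]
    constructor
    · refine (ae_restrict_iff' measurableSet_Ioi).2 (ae_of_all _ fun t ht => ?_)
      have ht : 0 < t := ht
      simp only [hinner t ht]
      have := integrableOn_rpow_mul_exp_neg_mul_rpow (p := 1) (s := q - 1) (b := 1 / t)
        (by linarith) (by norm_num) (by positivity)
      simp only [Real.rpow_one] at this
      refine (this.const_mul (Real.exp (-t) * t ^ (μ - 1))).congr (ae_of_all _ fun w => ?_)
      simp only [neg_mul]
    · have h1 := (Real.GammaIntegral_convergent (s := q + μ) (by positivity)).const_mul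
        (Real.Gamma q)
      refine h1.congr ((ae_restrict_iff' measurableSet_Ioi).2 (ae_of_all _ fun t ht => ?_))
      have ht : 0 < t := ht
      change Real.Gamma q * (Real.exp (-t) * t ^ (q + μ - 1)) = ∫ w in Set.Ioi (0 : ℝ), ‖F (w, t)‖
      rw [← hval t ht]
      refine setIntegral_congr_fun measurableSet_Ioi fun w hw => ?_
      have hw : 0 < w := hw
      simp only [F]
      rw [Real.norm_eq_abs, abs_of_pos (by positivity)]
  have e : ∀ w, ∫ t in Set.Ioi (0 : ℝ), F (w, t) = w ^ (q - 1) * besselInt μ w := by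
    intro w
    simp only [F]
    rw [integral_const_mul, besselInt]
  refine ⟨?_, ?_⟩
  · have := hint.integral_prod_left
    simp only [e] at this
    exact this
  · simp only [← e]
    rw [integral_integral_swap (f := fun w t => F (w, t)) hint,
      setIntegral_congr_fun measurableSet_Ioi (fun t ht => hval t ht), integral_const_mul,
      Real.Gamma_eq_integral (s := q + μ) (by positivity)]

/-! ### Laguerre functions of `x ^ (2n)` -/

/-- The Laguerre parameter (plus one) `(2a + 1) / (2n)` attached to the monomials
`x ^ (2nl + a)`. -/
noncomputable def gammaShift (n a : ℕ) : ℝ := (2 * a + 1) / (2 * n)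

/-- The coefficients of the Bessel-type series in the kernels. -/
noncomputable def besselCoeff (n a l : ℕ) : ℝ :=
  2 ^ l / ((2 * n : ℝ) ^ (2 * l) * Real.Gamma (l + gammaShift n a) * l.factorial)

/-- Up to normalization, `x ^ a` times the `k`-th Laguerre polynomial in `x ^ (2n) / n`: the
coefficient of `z ^ (2nk + a)` in `e^(-z^(2n)/(2n)) ∑ besselCoeff n a l * (z x)^(2nl + a)`. -/
noncomputable def laguerre (n a k : ℕ) (x : ℝ) : ℝ :=
  ∑ ij ∈ Finset.HasAntidiagonal.antidiagonal k, ((-1 / (2 * n : ℝ)) ^ ij.1 / ij.1.factorial) *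
    (besselCoeff n a ij.2 * x ^ (2 * n * ij.2 + a))

/-- The normalization of the kernel on the monomials `z ^ (2nk + a)`. -/
noncomputable def sectorConst (n a : ℕ) : ℝ :=
  (2 : ℝ) ^ (-(gammaShift n a - 1 / (2 * n)) / 2) *
    (n : ℝ) ^ (1 / 2 - 1 / (2 * n) / 2 - (gammaShift n a - 1 / (2 * n) : ℝ)) *
    √(Real.Gamma (1 / (2 * n : ℝ)))

/-- The normalization of `z ^ (2nk + a)`. -/
noncomputable def sectorCoeff (n a k : ℕ) : ℝ :=
  √(Real.Gamma (1 / (2 * n : ℝ)) / ((2 * n : ℝ) ^ (2 * (k : ℝ) + (gammaShift n a - 1 / (2 * n))) *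
    Real.Gamma (k + gammaShift n a) * k.factorial))

/-- The normalized Laguerre function corresponding to the monomial `z ^ (2nk + a)`. -/
noncomputable def sectorFun (n a k : ℕ) (x : ℝ) : ℝ :=
  sectorConst n a / sectorCoeff n a k * laguerre n a k x * Real.exp (-x ^ (2 * n) / (2 * n))

section

variable {n : ℕ}

lemma gammaShift_pos (hn : 1 ≤ n) (a : ℕ) : 0 < gammaShift n a := by
  have : (0 : ℝ) < n := by exact_mod_cast hn
  unfold gammaShift; positivity

lemma Gamma_shift_pos (hn : 1 ≤ n) (a l : ℕ) : 0 < Real.Gamma (l + gammaShift n a) :=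
  Real.Gamma_pos_of_pos (by have := gammaShift_pos hn a; positivity)

lemma besselCoeff_pos (hn : 1 ≤ n) (a l : ℕ) : 0 < besselCoeff n a l := by
  have : (0 : ℝ) < n := by exact_mod_cast hn
  have := Gamma_shift_pos hn a l
  unfold besselCoeff; positivity

lemma Gamma_nu_pos (hn : 1 ≤ n) : 0 < Real.Gamma (1 / (2 * n : ℝ)) := by
  have : (0 : ℝ) < n := by exact_mod_cast hn
  exact Real.Gamma_pos_of_pos (by positivity)

lemma sectorConst_pos (hn : 1 ≤ n) (a : ℕ) : 0 < sectorConst n a := by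
  have : (0 : ℝ) < n := by exact_mod_cast hn
  have := Gamma_nu_pos hn
  unfold sectorConst; positivity

lemma sectorCoeff_pos (hn : 1 ≤ n) (a k : ℕ) : 0 < sectorCoeff n a k := by
  have : (0 : ℝ) < n := by exact_mod_cast hn
  have := Gamma_nu_pos hn
  have := Gamma_shift_pos hn a k
  unfold sectorCoeff; positivity

lemma sectorCoeff_sq (hn : 1 ≤ n) (a k : ℕ) : sectorCoeff n a k ^ 2 =
    Real.Gamma (1 / (2 * n : ℝ)) / ((2 * n : ℝ) ^ (2 * (k : ℝ) + (gammaShift n a - 1 / (2 * n))) *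
    Real.Gamma (k + gammaShift n a) * k.factorial) := by
  have : (0 : ℝ) < n := by exact_mod_cast hn
  have := Gamma_nu_pos hn
  have := Gamma_shift_pos hn a k
  unfold sectorCoeff
  rw [Real.sq_sqrt (by positivity)]

lemma integrable_pow_mul_exp (hn : 1 ≤ n) (N : ℕ) {c : ℝ} (hc : 0 < c) :
    Integrable fun x : ℝ => x ^ N * Real.exp (-c * x ^ (2 * n)) := by
  have h0 : IntegrableOn (fun x : ℝ => x ^ N * Real.exp (-c * x ^ (2 * n))) (Set.Ioi 0) := by
    have := integrableOn_rpow_mul_exp_neg_mul_rpow (p := ((2 * n : ℕ) : ℝ)) (s := (N : ℝ)) (b := c)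
      (by have := N.cast_nonneg (α := ℝ); linarith) (by norm_cast; omega) hc
    simpa only [Real.rpow_natCast] using this
  rw [← integrableOn_univ, ← Set.Iio_union_Ici (a := (0 : ℝ)), integrableOn_union,
    integrableOn_Ici_iff_integrableOn_Ioi]
  refine ⟨?_, h0⟩
  rw [← (Measure.measurePreserving_neg (volume : Measure ℝ)).integrableOn_comp_preimage
    (Homeomorph.neg ℝ).measurableEmbedding]
  simp only [Set.neg_preimage, Set.neg_Iio, neg_zero]
  refine (h0.const_mul ((-1) ^ N)).congr (ae_of_all _ fun x => ?_)
  simp only [Function.comp_apply]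
  rw [(even_two_mul n).neg_pow, neg_pow x N, mul_assoc]

lemma integral_even_pow_mul_exp (hn : 1 ≤ n) (N : ℕ) :
    ∫ x : ℝ, x ^ (2 * N) * Real.exp (-x ^ (2 * n) / n) =
      1 / n * (n : ℝ) ^ ((2 * N + 1 : ℝ) / (2 * n)) * Real.Gamma ((2 * N + 1 : ℝ) / (2 * n)) := by
  have hn0 : (0 : ℝ) < n := by exact_mod_cast hn
  have h1 := integral_comp_abs (f := fun x : ℝ => x ^ (2 * N) * Real.exp (-x ^ (2 * n) / n))
  simp only [(even_two_mul N).pow_abs, (even_two_mul n).pow_abs] at h1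
  have h2 := integral_rpow_mul_exp_neg_mul_rpow (p := ((2 * n : ℕ) : ℝ)) (q := ((2 * N : ℕ) : ℝ))
    (b := 1 / n) (by norm_cast; omega)
    (by have := (2 * N).cast_nonneg (α := ℝ); linarith) (by positivity)
  simp only [Real.rpow_natCast] at h2
  rw [h1]
  have h3 : ∫ x in Set.Ioi (0 : ℝ), x ^ (2 * N) * Real.exp (-x ^ (2 * n) / n)
      = ∫ x in Set.Ioi (0 : ℝ), x ^ (2 * N) * Real.exp (-(1 / (n : ℝ)) * x ^ (2 * n)) := by
    congr 1 with x
    congr 2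
    ring
  rw [h3, h2]
  push_cast
  rw [one_div, Real.inv_rpow hn0.le, neg_div, Real.rpow_neg hn0.le, inv_inv]
  field_simp

lemma Gamma_add_nat {x : ℝ} (hx : 0 < x) (i : ℕ) :
    Real.Gamma (x + i) = (ascPochhammer ℝ i).eval x * Real.Gamma x := by
  induction i with
  | zero => simp
  | succ i ih =>
    rw [ascPochhammer_succ_eval, Nat.cast_succ, ← add_assoc, Real.Gamma_add_one (by positivity), ih]
    ring

/-- Finite differences of the polynomial `Γ(y + i) / Γ(y)`; this is the orthogonality of the
Laguerre polynomials. -/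
lemma sum_choose_mul_ascPochhammer (s : ℝ) {i k : ℕ} (hik : i ≤ k) :
    ∑ j ∈ Finset.range (k + 1), (-1 : ℝ) ^ (k - j) * k.choose j *
      (ascPochhammer ℝ i).eval (s + j) = if i = k then (k.factorial : ℝ) else 0 := by
  have h := fwdDiff_iter_eq_sum_shift (1 : ℝ) (ascPochhammer ℝ i).eval k s
  have h2 : ∑ j ∈ Finset.range (k + 1), (-1 : ℝ) ^ (k - j) * k.choose j *
      (ascPochhammer ℝ i).eval (s + j) = (fwdDiff (1 : ℝ))^[k] (ascPochhammer ℝ i).eval s := by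
    rw [h]
    refine Finset.sum_congr rfl fun j _ => ?_
    simp [zsmul_eq_mul]
  rw [h2]
  split_ifs with hk
  · subst hk
    have h3 := Polynomial.fwdDiff_iter_degree_eq_factorial (ascPochhammer ℝ i)
    rw [ascPochhammer_natDegree, (monic_ascPochhammer ℝ i).leadingCoeff] at h3
    rw [h3]; simp
  · have h3 := Polynomial.fwdDiff_iter_eq_zero_of_degree_lt (P := ascPochhammer ℝ i) (n := k)
      (by rw [ascPochhammer_natDegree]; omega)
    rw [h3]; rfl

lemma integrable_pow_mul_pow_mul_exp (hn : 1 ≤ n) (p q : ℕ) :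
    Integrable fun x : ℝ => x ^ p * x ^ q * Real.exp (-x ^ (2 * n) / n) := by
  have hn0 : (0 : ℝ) < n := by exact_mod_cast hn
  refine (integrable_pow_mul_exp hn (p + q) (one_div_pos.2 hn0)).congr (ae_of_all _ fun x => ?_)
  simp only
  rw [pow_add]
  congr 2
  ring

lemma integrable_laguerre_mul_pow (hn : 1 ≤ n) (a k q : ℕ) :
    Integrable fun x : ℝ => laguerre n a k x * x ^ q * Real.exp (-x ^ (2 * n) / n) := by
  simp only [laguerre, Finset.sum_mul]
  refine integrable_finsetSum _ fun ij _ => ?_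
  refine ((integrable_pow_mul_pow_mul_exp hn (2 * n * ij.2 + a) q).const_mul
    (((-1 / (2 * n : ℝ)) ^ ij.1 / ij.1.factorial) * besselCoeff n a ij.2)).congr
    (ae_of_all _ fun x => ?_)
  simp only; ring

lemma integral_laguerre_mul_pow (hn : 1 ≤ n) (a : ℕ) {i k : ℕ} (hik : i ≤ k) :
    ∫ x : ℝ, laguerre n a k x * x ^ (2 * n * i + a) * Real.exp (-x ^ (2 * n) / n) =
      if i = k then 1 / n * (n : ℝ) ^ (gammaShift n a + k) / (2 * n : ℝ) ^ k else 0 := by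
  have hn0 : (0 : ℝ) < n := by exact_mod_cast hn
  set s := gammaShift n a with hs
  have hs0 : 0 < s := gammaShift_pos hn a
  have hterm : ∀ ij ∈ Finset.HasAntidiagonal.antidiagonal k,
      ∫ x : ℝ, ((-1 / (2 * n : ℝ)) ^ ij.1 / ij.1.factorial) *
        (besselCoeff n a ij.2 * x ^ (2 * n * ij.2 + a)) * x ^ (2 * n * i + a) *
        Real.exp (-x ^ (2 * n) / n)
      = (1 / n * (n : ℝ) ^ (s + i) / (2 * n : ℝ) ^ k / k.factorial) *
        ((-1 : ℝ) ^ (k - ij.2) * k.choose ij.2 * (ascPochhammer ℝ i).eval (s + ij.2)) := by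
    rintro ⟨p, q⟩ hpq
    have hpq : p + q = k := Finset.HasAntidiagonal.mem_antidiagonal.1 hpq
    simp only
    have h1 := integral_even_pow_mul_exp hn (n * q + n * i + a)
    have e1 : (2 * ((n * q + n * i + a : ℕ) : ℝ) + 1) / (2 * n) = (s + q) + i := by
      rw [hs, gammaShift]; push_cast; field_simp; ring
    rw [e1, Gamma_add_nat (by positivity)] at h1
    have h2 : ∀ x : ℝ, ((-1 / (2 * n : ℝ)) ^ p / p.factorial) *
        (besselCoeff n a q * x ^ (2 * n * q + a)) * x ^ (2 * n * i + a) *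
        Real.exp (-x ^ (2 * n) / n) = (((-1 / (2 * n : ℝ)) ^ p / p.factorial) *
        besselCoeff n a q) * (x ^ (2 * (n * q + n * i + a)) * Real.exp (-x ^ (2 * n) / n)) := by
      intro x
      rw [show 2 * (n * q + n * i + a) = (2 * n * q + a) + (2 * n * i + a) by ring, pow_add]
      ring
    simp only [h2]
    rw [integral_const_mul, h1, besselCoeff, ← hs, show s + (q : ℝ) + i = (s + i) + q by ring,
      Real.rpow_add hn0, Real.rpow_natCast, show (q : ℝ) + s = s + q by ring]
    have hG : 0 < Real.Gamma (s + q) := Real.Gamma_pos_of_pos (by positivity)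
    have hch : (k.choose q : ℝ) * p.factorial * q.factorial = k.factorial := by
      rw [← hpq, ← Nat.add_choose_mul_factorial_mul_factorial p q]
      push_cast; ring
    have hk : k - q = p := by omega
    rw [hk, ← hch, ← hpq, div_pow, mul_pow, mul_pow, pow_add, mul_pow, mul_pow]
    have hp := p.factorial_pos
    have hq := q.factorial_pos
    have hc : (0 : ℝ) < (p + q).choose q := by
      exact_mod_cast Nat.choose_pos (Nat.le_add_left q p)
    field_simp
    ring
  have h0 : ∀ x : ℝ, laguerre n a k x * x ^ (2 * n * i + a) * Real.exp (-x ^ (2 * n) / n) =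
      ∑ ij ∈ Finset.HasAntidiagonal.antidiagonal k, ((-1 / (2 * n : ℝ)) ^ ij.1 / ij.1.factorial) *
        (besselCoeff n a ij.2 * x ^ (2 * n * ij.2 + a)) * x ^ (2 * n * i + a) *
        Real.exp (-x ^ (2 * n) / n) := by
    intro x; rw [laguerre, Finset.sum_mul, Finset.sum_mul]
  simp only [h0]
  rw [integral_finsetSum, Finset.sum_congr rfl hterm, ← Finset.mul_sum,
    ← Finset.Nat.sum_antidiagonal_swap, Finset.Nat.sum_antidiagonal_eq_sum_range_succ_mk]
  · simp only [Prod.swap_prod_mk]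
    rw [sum_choose_mul_ascPochhammer s hik]
    split_ifs with h
    · subst h
      have := i.factorial_pos
      field_simp
    · simp
  · intro ij _
    refine ((integrable_pow_mul_pow_mul_exp hn (2 * n * ij.2 + a) (2 * n * i + a)).const_mul
      (((-1 / (2 * n : ℝ)) ^ ij.1 / ij.1.factorial) * besselCoeff n a ij.2)).congr
      (ae_of_all _ fun x => ?_)
    simp only; ring

lemma integral_laguerre_mul_laguerre (hn : 1 ≤ n) (a : ℕ) {i k : ℕ} (hik : i ≤ k) :
    ∫ x : ℝ, laguerre n a k x * laguerre n a i x * Real.exp (-x ^ (2 * n) / n) =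
      if i = k then besselCoeff n a k *
        (1 / n * (n : ℝ) ^ (gammaShift n a + k) / (2 * n : ℝ) ^ k) else 0 := by
  have h0 : ∀ x : ℝ, laguerre n a k x * laguerre n a i x * Real.exp (-x ^ (2 * n) / n) =
      ∑ ij ∈ Finset.HasAntidiagonal.antidiagonal i,
        (((-1 / (2 * n : ℝ)) ^ ij.1 / ij.1.factorial) * besselCoeff n a ij.2) *
        (laguerre n a k x * x ^ (2 * n * ij.2 + a) * Real.exp (-x ^ (2 * n) / n)) := by
    intro x
    rw [laguerre.eq_def n a i, Finset.mul_sum, Finset.sum_mul]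
    exact Finset.sum_congr rfl fun _ _ => by ring
  simp only [h0]
  rw [integral_finsetSum _
    (fun ij _ => (integrable_laguerre_mul_pow hn a k (2 * n * ij.2 + a)).const_mul _)]
  have h1 : ∀ ij ∈ Finset.HasAntidiagonal.antidiagonal i, ij ≠ (0, i) →
      ∫ x : ℝ, (((-1 / (2 * n : ℝ)) ^ ij.1 / ij.1.factorial) * besselCoeff n a ij.2) *
        (laguerre n a k x * x ^ (2 * n * ij.2 + a) * Real.exp (-x ^ (2 * n) / n)) = 0 := by
    rintro ⟨p, q⟩ hpq hne
    have hpq : p + q = i := Finset.HasAntidiagonal.mem_antidiagonal.1 hpq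
    have hp : p ≠ 0 := by
      rintro rfl
      exact hne (by rw [← hpq, zero_add])
    simp only
    rw [integral_const_mul, integral_laguerre_mul_pow hn a (by omega : q ≤ k), if_neg (by omega),
      mul_zero]
  rw [Finset.sum_eq_single_of_mem (0, i) (by simp) h1]
  simp only
  rw [integral_const_mul, integral_laguerre_mul_pow hn a hik]
  split_ifs with h
  · subst h; simp
  · simp

lemma sectorFun_mul (hn : 1 ≤ n) (a a' k k' : ℕ) (x : ℝ) :
    sectorFun n a k x * sectorFun n a' k' x =
      (sectorConst n a / sectorCoeff n a k * (sectorConst n a' / sectorCoeff n a' k')) *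
      (laguerre n a k x * laguerre n a' k' x * Real.exp (-x ^ (2 * n) / n)) := by
  have hn0 : (0 : ℝ) < n := by exact_mod_cast hn
  have h : Real.exp (-x ^ (2 * n) / n) =
      Real.exp (-x ^ (2 * n) / (2 * n)) * Real.exp (-x ^ (2 * n) / (2 * n)) := by
    rw [← Real.exp_add]; congr 1; field_simp; ring
  rw [sectorFun, sectorFun, h]; ring

lemma sectorConst_sq (hn : 1 ≤ n) (a : ℕ) : sectorConst n a ^ 2 * (1 / n *
    (n : ℝ) ^ gammaShift n a) = Real.Gamma (1 / (2 * n : ℝ)) /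
      (2 * n : ℝ) ^ (gammaShift n a - 1 / (2 * n)) := by
  have hn0 : (0 : ℝ) < n := by exact_mod_cast hn
  set s := gammaShift n a
  set ν : ℝ := 1 / (2 * n) with hν
  have hG : 0 < Real.Gamma ν := Gamma_nu_pos hn
  rw [sectorConst, mul_pow, mul_pow, Real.sq_sqrt hG.le, Real.mul_rpow (by norm_num) hn0.le,
    ← Real.rpow_natCast, ← Real.rpow_natCast, ← Real.rpow_mul (by norm_num), ← Real.rpow_mul hn0.le]
  have e1 : (2 : ℝ) ^ (-(s - ν) / 2 * (2 : ℕ)) * (2 : ℝ) ^ (s - ν) = 1 := by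
    rw [← Real.rpow_add (by norm_num)]; simp
  have e2 : (n : ℝ) ^ ((1 / 2 - ν / 2 - (s - ν)) * (2 : ℕ)) * (n : ℝ) ^ s * (n : ℝ) ^ (s - ν)
      = n := by
    rw [← Real.rpow_add hn0, ← Real.rpow_add hn0]
    conv_rhs => rw [← Real.rpow_one (n : ℝ)]
    congr 1; push_cast; ring
  have h1 : 0 < (2 : ℝ) ^ (s - ν) := by positivity
  have h2 : 0 < (n : ℝ) ^ (s - ν) := by positivity
  rw [eq_div_iff (by positivity)]
  rw [show ∀ A B C D E F : ℝ, A * B * C * (1 / n * D) * (E * F)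
    = C * (A * E) * (B * D * F) * (1 / n) by intros; ring, e1, e2]
  field_simp

lemma integral_sectorFun_mul_sectorFun (hn : 1 ≤ n) (a i k : ℕ) :
    ∫ x : ℝ, sectorFun n a k x * sectorFun n a i x = if i = k then 1 else 0 := by
  have hn0 : (0 : ℝ) < n := by exact_mod_cast hn
  wlog hik : i ≤ k generalizing i k
  · have h := this k i (by omega)
    simp only [mul_comm (sectorFun n a k _)]
    rw [h]
    simp only [eq_comm]
  simp only [sectorFun_mul hn]
  rw [integral_const_mul, integral_laguerre_mul_laguerre hn a hik]
  split_ifs with h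
  · subst h
    have hc := sectorCoeff_pos hn a i
    have hG := Gamma_shift_pos hn a i
    have hGν := Gamma_nu_pos hn
    have h1 := sectorCoeff_sq hn a i
    have h2 := sectorConst_sq hn a
    have e : ((2 : ℝ) * n) ^ (2 * (i : ℝ)) = ((2 : ℝ) * n) ^ (2 * i) := by
      rw [← Real.rpow_natCast]; push_cast; rfl
    rw [Real.rpow_add (by positivity), e] at h1
    rw [Real.rpow_add hn0, Real.rpow_natCast]
    have h3 : sectorConst n a / sectorCoeff n a i * (sectorConst n a / sectorCoeff n a i) *
        (besselCoeff n a i * (1 / n * ((n : ℝ) ^ gammaShift n a * n ^ i) / (2 * n : ℝ) ^ i)) =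
        (sectorConst n a ^ 2 * (1 / n * (n : ℝ) ^ gammaShift n a)) * besselCoeff n a i * n ^ i /
        (2 * n : ℝ) ^ i / sectorCoeff n a i ^ 2 := by
      field_simp
    rw [h3, h2, h1, besselCoeff]
    field_simp
    rw [mul_pow]
  · simp

lemma sectorFun_neg (n a k : ℕ) (x : ℝ) :
    sectorFun n a k (-x) = (-1) ^ a * sectorFun n a k x := by
  have h : laguerre n a k (-x) = (-1) ^ a * laguerre n a k x := by
    rw [laguerre, laguerre, Finset.mul_sum]
    refine Finset.sum_congr rfl fun ij _ => ?_
    rw [neg_pow x, pow_add, mul_assoc 2, pow_mul]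
    simp only [even_two, Even.neg_pow, one_pow, one_mul]
    ring
  rw [sectorFun, sectorFun, h, (even_two_mul n).neg_pow]
  ring

lemma integral_sectorFun_mul_of_odd (n : ℕ) {a a' : ℕ} (h : Odd (a + a')) (k k' : ℕ) :
    ∫ x : ℝ, sectorFun n a k x * sectorFun n a' k' x = 0 := by
  have h1 := integral_neg_eq_self (fun x : ℝ => sectorFun n a k x * sectorFun n a' k' x) volume
  have h2 : ∀ x : ℝ, sectorFun n a k (-x) * sectorFun n a' k' (-x)
      = -(sectorFun n a k x * sectorFun n a' k' x) := by
    intro x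
    rw [sectorFun_neg, sectorFun_neg]
    have := h.neg_one_pow (α := ℝ)
    rw [pow_add] at this
    linear_combination (sectorFun n a k x * sectorFun n a' k' x) * this
  simp only [h2, integral_neg] at h1
  linarith

lemma memLp_pow_mul_exp (hn : 1 ≤ n) (N : ℕ) {c : ℝ} (hc : 0 < c) :
    MemLp (fun x : ℝ => x ^ N * Real.exp (-c * x ^ (2 * n))) 2 volume := by
  rw [memLp_two_iff_integrable_sq (by fun_prop)]
  refine (integrable_pow_mul_exp hn (2 * N) (c := 2 * c) (by positivity)).congr
    (ae_of_all _ fun x => ?_)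
  simp only
  rw [mul_pow, ← pow_mul, mul_comm N, ← Real.exp_nat_mul]
  congr 2; push_cast; ring

lemma memLp_sectorFun (hn : 1 ≤ n) (a k : ℕ) : MemLp (sectorFun n a k) 2 volume := by
  have hn0 : (0 : ℝ) < n := by exact_mod_cast hn
  have h1 : sectorFun n a k = fun x => ∑ ij ∈ Finset.HasAntidiagonal.antidiagonal k,
      (sectorConst n a / sectorCoeff n a k * ((-1 / (2 * n : ℝ)) ^ ij.1 / ij.1.factorial) *
        besselCoeff n a ij.2) *
      (x ^ (2 * n * ij.2 + a) * Real.exp (-(1 / (2 * n)) * x ^ (2 * n))) := by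
    ext x
    rw [sectorFun, laguerre, Finset.mul_sum, Finset.sum_mul]
    refine Finset.sum_congr rfl fun ij _ => ?_
    rw [show -x ^ (2 * n) / (2 * n) = -(1 / (2 * n)) * x ^ (2 * n) by ring]
    ring
  rw [h1]
  exact memLp_finsetSum _ fun ij _ =>
    (memLp_pow_mul_exp hn (2 * n * ij.2 + a) (c := 1 / (2 * n)) (by positivity)).const_mul _

/-! ### The generating function -/

lemma summable_besselCoeff (hn : 1 ≤ n) (a : ℕ) (y : ℝ) :
    Summable fun l => besselCoeff n a l * y ^ l := by
  have hn0 : (0 : ℝ) < n := by exact_mod_cast hn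
  refine (summable_besselV (gammaShift_pos hn a) (2 * y / (2 * n) ^ 2)).congr fun l => ?_
  have := Gamma_shift_pos hn a l
  rw [besselCoeff, div_pow, mul_pow 2 y, ← pow_mul]
  field_simp

lemma summable_norm_besselCoeff_mul (hn : 1 ≤ n) (a : ℕ) (z : ℂ) :
    Summable fun l => ‖(besselCoeff n a l : ℂ) * z ^ (2 * n * l + a)‖ := by
  refine ((summable_besselCoeff hn a (‖z‖ ^ (2 * n))).mul_right (‖z‖ ^ a)).congr fun l => ?_
  rw [norm_mul, Complex.norm_real, norm_pow, Real.norm_eq_abs, abs_of_pos (besselCoeff_pos hn a l),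
    pow_add, pow_mul]
  ring

/-- The part of the kernels that involves the monomials `z ^ (2nl + a)`. -/
noncomputable def sectorKernel (n a : ℕ) (z : ℂ) (x : ℝ) : ℂ :=
  Complex.exp (-z ^ (2 * n) / (2 * n)) *
    ((sectorConst n a : ℂ) * ∑' l, (besselCoeff n a l : ℂ) * (z * x) ^ (2 * n * l + a)) *
    Complex.exp (-(x : ℂ) ^ (2 * n) / (2 * n))

/-- The generating function of the Laguerre functions. -/
lemma hasSum_sectorKernel (hn : 1 ≤ n) (a : ℕ) (z : ℂ) (x : ℝ) :
    HasSum (fun k => ((sectorCoeff n a k : ℂ) * z ^ (2 * n * k + a)) * (sectorFun n a k x : ℂ))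
      (sectorKernel n a z x) := by
  have hn0 : (0 : ℝ) < n := by exact_mod_cast hn
  set f : ℕ → ℂ := fun i => (-z ^ (2 * n) / (2 * n)) ^ i / i.factorial
  set g : ℕ → ℂ := fun l => (besselCoeff n a l : ℂ) * (z * x) ^ (2 * n * l + a)
  have hf : Summable fun i => ‖f i‖ := NormedSpace.norm_expSeries_div_summable _
  have hg : Summable fun l => ‖g l‖ := summable_norm_besselCoeff_mul hn a _
  have h1 := (summable_norm_sum_mul_antidiagonal_of_summable_norm hf hg).of_norm.hasSum
  rw [← tsum_mul_tsum_eq_tsum_sum_antidiagonal_of_summable_norm hf hg] at h1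
  have h2 : ∑' i, f i = Complex.exp (-z ^ (2 * n) / (2 * n)) := by
    rw [Complex.exp_eq_exp_ℂ, NormedSpace.exp_eq_tsum_div]
  rw [h2] at h1
  have h3 := (h1.mul_left (sectorConst n a : ℂ)).mul_right
    (Complex.exp (-(x : ℂ) ^ (2 * n) / (2 * n)))
  have hfun : (fun k => ((sectorCoeff n a k : ℂ) * z ^ (2 * n * k + a)) * (sectorFun n a k x : ℂ))
      = fun k => (sectorConst n a : ℂ) * (∑ ij ∈ Finset.HasAntidiagonal.antidiagonal k,
        f ij.1 * g ij.2) * Complex.exp (-(x : ℂ) ^ (2 * n) / (2 * n)) := by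
    funext k
    have hc : (sectorCoeff n a k : ℂ) ≠ 0 := by exact_mod_cast (sectorCoeff_pos hn a k).ne'
    have h4 : ∑ ij ∈ Finset.HasAntidiagonal.antidiagonal k, f ij.1 * g ij.2
        = z ^ (2 * n * k + a) * (laguerre n a k x : ℂ) := by
      rw [laguerre]
      push_cast
      rw [Finset.mul_sum]
      refine Finset.sum_congr rfl fun ij hij => ?_
      have hij : ij.1 + ij.2 = k := Finset.HasAntidiagonal.mem_antidiagonal.1 hij
      simp only [f, g]
      rw [← hij, mul_pow, show -z ^ (2 * n) / (2 * n) = z ^ (2 * n) * (-1 / (2 * n)) by ring,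
        mul_pow, ← pow_mul, show 2 * n * (ij.1 + ij.2) + a = 2 * n * ij.1 + (2 * n * ij.2 + a) by
          ring, pow_add z (2 * n * ij.1)]
      ring
    rw [h4, sectorFun]
    push_cast
    field_simp
  have hval : sectorKernel n a z x = (sectorConst n a : ℂ) *
      (Complex.exp (-z ^ (2 * n) / (2 * n)) * ∑' l, g l) *
        Complex.exp (-(x : ℂ) ^ (2 * n) / (2 * n)) := by
    rw [sectorKernel]; ring
  rw [hfun, hval]
  exact h3

lemma summable_sectorCoeff_sq (hn : 1 ≤ n) (a : ℕ) (r : ℝ) :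
    Summable fun k => (sectorCoeff n a k * r ^ (2 * n * k + a)) ^ 2 := by
  have hn0 : (0 : ℝ) < n := by exact_mod_cast hn
  refine ((summable_besselV (gammaShift_pos hn a) ((r ^ (2 * n) / (2 * n)) ^ 2)).mul_left
    (Real.Gamma (1 / (2 * n : ℝ)) / (2 * n : ℝ) ^ (gammaShift n a - 1 / (2 * n)) *
      (r ^ a) ^ 2)).congr fun k => ?_
  have := Gamma_shift_pos hn a k
  have e : ((2 : ℝ) * n) ^ (2 * (k : ℝ)) = ((2 * n : ℝ) ^ 2) ^ k := by
    rw [← pow_mul, ← Real.rpow_natCast]; push_cast; rfl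
  have e2 : (r ^ (2 * n * k + a)) ^ 2 = ((r ^ (2 * n)) ^ 2) ^ k * (r ^ a) ^ 2 := by ring
  rw [mul_pow, sectorCoeff_sq hn, Real.rpow_add (by positivity), e, e2, div_pow, div_pow]
  field_simp

end

/-! ### Completeness -/

open ProbabilityTheory in
/-- A density `g` for which `e^(δX) g` is integrable is determined, on the events that depend on
`X` only, by the moments of `X`: the positive and the negative part of `g` give `X` the same
moments, so their complex moment generating functions have the same Taylor series at `0`, and they
are equal on the half plane `re z < δ`, in particular on the imaginary axis. -/
lemma setIntegral_preimage_eq_zero_of_moments {X g : ℝ → ℝ} (hX : Measurable X)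
    (hX0 : ∀ x, 0 ≤ X x) (hg : Measurable g) {δ : ℝ} (hδ : 0 < δ)
    (hint : Integrable fun x => g x * Real.exp (δ * X x))
    (hmom : ∀ k : ℕ, ∫ x, g x * X x ^ k = 0) {S : Set ℝ} (hS : MeasurableSet S) :
    ∫ x in X ⁻¹' S, g x = 0 := by
  have hgi : Integrable g := hint.mono hg.aestronglyMeasurable (ae_of_all _ fun x => by
    rw [norm_mul]
    refine le_mul_of_one_le_right (norm_nonneg _) ?_
    rw [Real.norm_eq_abs, abs_of_pos (Real.exp_pos _)]
    exact Real.one_le_exp (mul_nonneg hδ.le (hX0 x)))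
  set P : (ℝ → ℝ) → Measure ℝ := fun h => volume.withDensity fun x => ENNReal.ofReal (h x) with hP
  have hfin : ∀ h : ℝ → ℝ, Integrable h → IsFiniteMeasure (P h) := fun h hh =>
    isFiniteMeasure_withDensity_ofReal hh.2
  -- integration against the part of the measure
  have hPint : ∀ (h u : ℝ → ℝ), Measurable h → ∫ x, u x ∂(P h) = ∫ x, max (h x) 0 * u x := by
    intro h u hh
    simp only [hP]
    rw [integral_withDensity_eq_integral_toReal_smul hh.ennreal_ofReal
      (ae_of_all _ fun x => ENNReal.ofReal_lt_top)]
    simp only [ENNReal.toReal_ofReal', smul_eq_mul]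
  have hexp : ∀ h : ℝ → ℝ, Measurable h → (∀ x, |h x| ≤ |g x|) → Set.Iic δ ⊆
      integrableExpSet X (P h) := by
    intro h hh hle t ht
    have ht : t ≤ δ := ht
    change Integrable (fun x => Real.exp (t * X x)) (P h)
    rw [integrable_withDensity_iff_integrable_smul' hh.ennreal_ofReal
      (ae_of_all _ fun x => ENNReal.ofReal_lt_top)]
    refine hint.mono (by fun_prop) (ae_of_all _ fun x => ?_)
    rw [norm_smul, norm_mul, ENNReal.toReal_ofReal', Real.norm_eq_abs, Real.norm_eq_abs,
      Real.norm_eq_abs, Real.norm_eq_abs, abs_of_pos (Real.exp_pos _), abs_of_pos (Real.exp_pos _)]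
    have h1 : |max (h x) 0| ≤ |g x| := by
      rw [abs_of_nonneg (le_max_right _ _)]
      exact (max_le (le_abs_self _) (abs_nonneg _)).trans (hle x)
    have h2 := hX0 x
    gcongr
  have hI : ∀ h : ℝ → ℝ, Measurable h → (∀ x, |h x| ≤ |g x|) → ∀ z : ℂ, z.re < δ →
      z.re ∈ interior (integrableExpSet X (P h)) := by
    intro h hh hle z hz
    exact interior_mono (hexp h hh hle) (by rw [interior_Iic]; exact hz)
  have hle1 : ∀ x, |g x| ≤ |g x| := fun x => le_rfl
  have hle2 : ∀ x, |(-g) x| ≤ |g x| := fun x => by simp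
  have hf1 := hfin g hgi
  have hf2 := hfin (-g) hgi.neg
  have hder : ∀ k : ℕ, iteratedDeriv k (complexMGF X (P g)) 0
      = iteratedDeriv k (complexMGF X (P (-g))) 0 := by
    intro k
    rw [iteratedDeriv_complexMGF (hI g hg hle1 0 (by simpa using hδ)),
      iteratedDeriv_complexMGF (hI (-g) hg.neg hle2 0 (by simpa using hδ))]
    simp only [zero_mul, Complex.exp_zero, mul_one]
    have hmi : Integrable fun x => g x * X x ^ k := by
      have h1 : Integrable (fun x => X x ^ k) (P g) :=
        integrable_pow_of_mem_interior_integrableExpSet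
          (by simpa using hI g hg hle1 0 (by simpa using hδ)) k
      have h2 : Integrable (fun x => X x ^ k) (P (-g)) :=
        integrable_pow_of_mem_interior_integrableExpSet
          (by simpa using hI (-g) hg.neg hle2 0 (by simpa using hδ)) k
      rw [integrable_withDensity_iff_integrable_smul' (by fun_prop)
        (ae_of_all _ fun x => ENNReal.ofReal_lt_top)] at h1 h2
      refine (h1.sub h2).congr (ae_of_all _ fun x => ?_)
      simp only [Pi.sub_apply, ENNReal.toReal_ofReal', smul_eq_mul, Pi.neg_apply]
      rw [← sub_mul, max_zero_sub_eq_self]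
    have h1 : Integrable (fun x => max (g x) 0 * X x ^ k) := by
      refine hmi.mono (by fun_prop) (ae_of_all _ fun x => ?_)
      rw [norm_mul, norm_mul]
      gcongr
      rw [Real.norm_eq_abs, abs_of_nonneg (le_max_right _ _)]
      exact max_le (le_abs_self _) (abs_nonneg _)
    have h2 : Integrable (fun x => max (-g x) 0 * X x ^ k) := by
      refine hmi.mono (by fun_prop) (ae_of_all _ fun x => ?_)
      rw [norm_mul, norm_mul]
      gcongr
      rw [Real.norm_eq_abs, abs_of_nonneg (le_max_right _ _)]
      exact max_le (neg_le_abs _) (abs_nonneg _)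
    have h3 : ∀ h : ℝ → ℝ, Measurable h → ∫ x, (X x : ℂ) ^ k ∂(P h)
        = ((∫ x, max (h x) 0 * X x ^ k : ℝ) : ℂ) := by
      intro h hh
      rw [← hPint h _ hh, ← integral_complex_ofReal]
      push_cast; rfl
    rw [h3 g hg, h3 (-g) hg.neg]
    congr 1
    rw [← sub_eq_zero]
    simp only [Pi.neg_apply]
    rw [← integral_sub h1 h2]
    refine Eq.trans ?_ (hmom k)
    congr 1 with x
    rw [← sub_mul, max_zero_sub_eq_self]
  have hD : ∀ h : ℝ → ℝ, Measurable h → (∀ x, |h x| ≤ |g x|) →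
      DifferentiableOn ℂ (complexMGF X (P h)) {z | z.re < δ} := fun h hh hle =>
    differentiableOn_complexMGF.mono fun z hz => hI h hh hle z hz
  have hopen : IsOpen {z : ℂ | z.re < δ} := isOpen_lt Complex.continuous_re continuous_const
  have hball : Metric.ball (0 : ℂ) δ ⊆ {z : ℂ | z.re < δ} := fun z hz => by
    have := mem_ball_zero_iff.1 hz
    exact (Complex.re_le_norm z).trans_lt this
  have hloc : complexMGF X (P g) =ᶠ[𝓝 0] complexMGF X (P (-g)) := by
    filter_upwards [Metric.ball_mem_nhds (0 : ℂ) hδ] with z hz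
    have h1 := Complex.hasSum_taylorSeries_on_ball ((hD g hg hle1).mono hball) hz
    have h2 := Complex.hasSum_taylorSeries_on_ball ((hD (-g) hg.neg hle2).mono hball) hz
    simp only [hder] at h1
    exact h1.unique h2
  have heq : Set.EqOn (complexMGF X (P g)) (complexMGF X (P (-g))) {z | z.re < δ} :=
    ((hD g hg hle1).analyticOnNhd hopen).eqOn_of_preconnected_of_eventuallyEq
      ((hD (-g) hg.neg hle2).analyticOnNhd hopen)
      (convex_halfSpace_re_lt δ).isPreconnected (z₀ := 0) (by simpa using hδ) hloc
  have hmap : (P g).map X = (P (-g)).map X := by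
    refine Measure.ext_of_charFun (funext fun t => ?_)
    rw [← complexMGF_mul_I hX.aemeasurable, ← complexMGF_mul_I hX.aemeasurable]
    exact heq (by simpa using hδ)
  have h1 := congrArg (fun μ => μ S) hmap
  simp only [Measure.map_apply hX hS] at h1
  simp only [hP] at h1
  rw [withDensity_apply _ (hX hS), withDensity_apply _ (hX hS)] at h1
  rw [integral_eq_lintegral_pos_part_sub_lintegral_neg_part hgi.integrableOn, h1]
  simp

/-- The functions `x ^ (2nk + a) e^(-x^(2n)/(2n))`, for all `k`, determine the part of an `L²`
function of the parity of `a`. -/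
lemma ae_add_comp_neg_eq_zero {n : ℕ} (hn : 1 ≤ n) (a : ℕ) {φ : ℝ → ℝ} (hφ : Measurable φ)
    (hφ2 : MemLp φ 2 volume)
    (hmom : ∀ k : ℕ, ∫ x, φ x * (x ^ (2 * n * k + a) * Real.exp (-x ^ (2 * n) / (2 * n))) = 0) :
    ∀ᵐ x : ℝ, φ x + (-1) ^ a * φ (-x) = 0 := by
  have hn0 : (0 : ℝ) < n := by exact_mod_cast hn
  set g : ℝ → ℝ := fun x => φ x * (x ^ a * Real.exp (-x ^ (2 * n) / (2 * n))) with hgdef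
  have hg : Measurable g := by fun_prop
  have hδ : (0 : ℝ) < 1 / (4 * n) := by positivity
  have hgint : Integrable fun x => g x * Real.exp (1 / (4 * n) * x ^ (2 * n)) := by
    refine (hφ2.integrable_mul (memLp_pow_mul_exp hn a hδ)).congr (ae_of_all _ fun x => ?_)
    simp only [g, Pi.mul_apply]
    rw [mul_assoc, mul_assoc, ← Real.exp_add]
    congr 3
    field_simp
    ring
  have hX0 : ∀ x : ℝ, 0 ≤ x ^ (2 * n) := fun x => (even_two_mul n).pow_nonneg x
  have hgi : Integrable g := hgint.mono hg.aestronglyMeasurable (ae_of_all _ fun x => by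
    rw [norm_mul (g x)]
    refine le_mul_of_one_le_right (norm_nonneg _) ?_
    rw [Real.norm_eq_abs, abs_of_pos (Real.exp_pos _)]
    exact Real.one_le_exp (mul_nonneg hδ.le (hX0 x)))
  have hsymm : ∀ E : Set ℝ, MeasurableSet E → (∀ x, -x ∈ E ↔ x ∈ E) → ∫ x in E, g x = 0 := by
    intro E hE hEs
    -- a symmetric set is a preimage under `x ↦ x ^ (2n)`
    have h1 : E = (fun x : ℝ => x ^ (2 * n)) ⁻¹' ((fun t : ℝ => t ^ (1 / (2 * n : ℝ))) ⁻¹' E) := by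
      ext x
      have h2 : (x ^ (2 * n)) ^ (1 / (2 * n : ℝ)) = |x| := by
        rw [← (even_two_mul n).pow_abs, ← Real.rpow_natCast, ← Real.rpow_mul (abs_nonneg x)]
        push_cast
        rw [mul_one_div_cancel (by positivity), Real.rpow_one]
      simp only [Set.mem_preimage]
      rw [h2]
      rcases abs_choice x with h | h
      · rw [h]
      · rw [h, hEs]
    rw [h1]
    refine setIntegral_preimage_eq_zero_of_moments (by fun_prop) hX0 hg hδ hgint (fun k => ?_)
      ((show Measurable (fun t : ℝ => t ^ (1 / (2 * n : ℝ))) by fun_prop) hE)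
    rw [← hmom k]
    congr 1 with x
    simp only [g]
    rw [pow_add x, pow_mul x (2 * n)]
    ring
  have hgneg : Integrable fun x => g (-x) := hgi.comp_neg
  have hG : (fun x => g x + g (-x)) =ᵐ[volume] 0 := by
    refine Integrable.ae_eq_zero_of_forall_setIntegral_eq_zero (hgi.add hgneg) fun s hs _ => ?_
    have hns : MeasurableSet (-s) := hs.neg
    have h1 : ∫ x in s, g (-x) = ∫ x in -s, g x := by
      have := (Measure.measurePreserving_neg (volume : Measure ℝ)).setIntegral_preimage_emb
        (Homeomorph.neg ℝ).measurableEmbedding g (-s)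
      rw [← this]
      simp
    have h2 : ∫ x in s ∪ -s, g x = 0 := hsymm _ (hs.union hns) fun x => by
      simp [or_comm]
    have h3 : ∫ x in -s ∩ s, g x = 0 := hsymm _ (hns.inter hs) fun x => by
      simp [and_comm]
    rw [← Set.union_sdiff_self, setIntegral_union Set.disjoint_sdiff_right (hns.diff hs)
      hgi.integrableOn hgi.integrableOn] at h2
    have h4 := integral_inter_add_sdiff hs (hgi.integrableOn (s := -s))
    rw [integral_add hgi.integrableOn hgneg.integrableOn, h1, ← h4, h3, zero_add, h2]
  have hne : ∀ᵐ x : ℝ, x ≠ 0 := by simp [ae_iff]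
  filter_upwards [hG, hne] with x hx hx0
  have h1 : g x + g (-x) = (φ x + (-1) ^ a * φ (-x)) *
      (x ^ a * Real.exp (-x ^ (2 * n) / (2 * n))) := by
    simp only [g]
    rw [(even_two_mul n).neg_pow, neg_pow x a]
    ring
  have h2 : g x + g (-x) = 0 := hx
  rw [h1] at h2
  exact (mul_eq_zero.1 h2).resolve_right (by positivity)

/-- By triangularity, orthogonality to the Laguerre functions is orthogonality to the monomials. -/
lemma integral_mul_pow_of_integral_mul_sectorFun {n : ℕ} (hn : 1 ≤ n) (a : ℕ) {φ : ℝ → ℝ}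
    (hφ2 : MemLp φ 2 volume) (h : ∀ k, ∫ x, φ x * sectorFun n a k x = 0) (k : ℕ) :
    ∫ x, φ x * (x ^ (2 * n * k + a) * Real.exp (-x ^ (2 * n) / (2 * n))) = 0 := by
  have hn0 : (0 : ℝ) < n := by exact_mod_cast hn
  have hi : ∀ N : ℕ, Integrable fun x => φ x * (x ^ N * Real.exp (-x ^ (2 * n) / (2 * n))) := by
    intro N
    refine (hφ2.integrable_mul (memLp_pow_mul_exp hn N (c := 1 / (2 * n)) (by positivity))).congr
      (ae_of_all _ fun x => ?_)
    simp only [Pi.mul_apply]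
    congr 3; ring
  induction k using Nat.strong_induction_on with
  | _ k ih =>
    have h1 := h k
    have hK : 0 < sectorConst n a / sectorCoeff n a k :=
      div_pos (sectorConst_pos hn a) (sectorCoeff_pos hn a k)
    have h2 : ∀ x, φ x * sectorFun n a k x =
        ∑ ij ∈ Finset.HasAntidiagonal.antidiagonal k,
        (sectorConst n a / sectorCoeff n a k * ((-1 / (2 * n : ℝ)) ^ ij.1 / ij.1.factorial) *
          besselCoeff n a ij.2) *
        (φ x * (x ^ (2 * n * ij.2 + a) * Real.exp (-x ^ (2 * n) / (2 * n)))) := by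
      intro x
      rw [sectorFun, laguerre, Finset.mul_sum, Finset.sum_mul, Finset.mul_sum]
      exact Finset.sum_congr rfl fun ij _ => by ring
    simp only [h2] at h1
    rw [integral_finsetSum _ fun ij _ => (hi _).const_mul _] at h1
    simp only [integral_const_mul] at h1
    rw [Finset.sum_eq_single_of_mem (0, k) (by simp)] at h1
    · have := besselCoeff_pos hn a k
      simpa [hK.ne', this.ne', (sectorConst_pos hn a).ne', (sectorCoeff_pos hn a k).ne'] using h1
    · rintro ⟨p, q⟩ hpq hne
      have hpq : p + q = k := Finset.HasAntidiagonal.mem_antidiagonal.1 hpq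
      have hp : p ≠ 0 := by
        rintro rfl
        exact hne (by rw [← hpq, zero_add])
      rw [ih q (by omega), mul_zero]

/-- The offset of the exponents in position `l`: `a` for even and `a'` for odd `l`. -/
def alternate (a a' l : ℕ) : ℕ := if Even l then a else a'

lemma ae_eq_zero_of_integral_mul_sectorFun {n : ℕ} (hn : 1 ≤ n) {a a' : ℕ} (haa : Odd (a + a'))
    {φ : ℝ → ℝ} (hφ : Measurable φ) (hφ2 : MemLp φ 2 volume)
    (h : ∀ l, ∫ x, φ x * sectorFun n (alternate a a' l) (l / 2) x = 0) : φ =ᵐ[volume] 0 := by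
  have h1 := ae_add_comp_neg_eq_zero hn a hφ hφ2
    (integral_mul_pow_of_integral_mul_sectorFun hn a hφ2 fun k => by
      simpa [alternate] using h (2 * k))
  have h2 := ae_add_comp_neg_eq_zero hn a' hφ hφ2
    (integral_mul_pow_of_integral_mul_sectorFun hn a' hφ2 fun k => by
      have := h (2 * k + 1)
      rwa [alternate, if_neg (by simp), show (2 * k + 1) / 2 = k by omega] at this)
  filter_upwards [h1, h2] with x hx hx'
  have h3 : (-1 : ℝ) ^ a + (-1) ^ a' = 0 := by
    have := haa.neg_one_pow (α := ℝ)
    rw [pow_add] at this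
    rcases neg_one_pow_eq_or ℝ a with h | h <;> rcases neg_one_pow_eq_or ℝ a' with h' | h' <;>
      rw [h, h'] at this ⊢ <;> linarith
  simp only [Pi.zero_apply]
  linear_combination (1 / 2) * hx + (1 / 2) * hx' - (1 / 2) * φ (-x) * h3

/-- The Laguerre functions of two sectors of opposite parity form a Hilbert basis. -/
theorem exists_hilbertBasis {n : ℕ} (hn : 1 ≤ n) {a a' : ℕ} (haa : Odd (a + a')) :
    ∃ b : HilbertBasis ℕ ℂ H, ∀ l, (b l : ℝ → ℂ) =ᵐ[volume]
      fun x => (sectorFun n (alternate a a' l) (l / 2) x : ℂ) := by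
  have hmem : ∀ l, MemLp (fun x => (sectorFun n (alternate a a' l) (l / 2) x : ℂ)) 2 volume :=
    fun l => (memLp_sectorFun hn _ _).ofReal
  set v : ℕ → H := fun l => (hmem l).toLp _
  have hv : ∀ l, (v l : ℝ → ℂ) =ᵐ[volume]
      fun x => (sectorFun n (alternate a a' l) (l / 2) x : ℂ) := fun l => (hmem l).coeFn_toLp
  have hort : Orthonormal ℂ v := by
    rw [orthonormal_iff_ite]
    intro l k
    rw [L2.inner_def]
    have h1 : ∫ x, inner ℂ ((v l : ℝ → ℂ) x) ((v k : ℝ → ℂ) x) =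
        ((∫ x, sectorFun n (alternate a a' l) (l / 2) x *
          sectorFun n (alternate a a' k) (k / 2) x : ℝ) : ℂ) := by
      rw [← integral_complex_ofReal]
      refine integral_congr_ae ?_
      filter_upwards [hv l, hv k] with x h1 h2
      rw [h1, h2, RCLike.inner_apply, Complex.conj_ofReal]
      push_cast; ring
    rw [h1]
    by_cases hpar : (Even l ↔ Even k)
    · have e : alternate a a' l = alternate a a' k := by simp only [alternate, hpar]
      rw [e, integral_sectorFun_mul_sectorFun hn]
      have : k / 2 = l / 2 ↔ l = k := by
        constructor
        · intro h
          rcases Nat.even_or_odd l with hl | hl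
          · have := hpar.1 hl
            grind
          · have : ¬ Even k := fun hk => (Nat.not_even_iff_odd.2 hl) (hpar.2 hk)
            grind
        · rintro rfl; rfl
      simp only [this]
      split_ifs <;> simp
    · have hodd : Odd (alternate a a' l + alternate a a' k) := by
        by_cases hl : Even l <;> by_cases hk : Even k
        · exact absurd (iff_of_true hl hk) hpar
        · rwa [alternate, alternate, if_pos hl, if_neg hk]
        · rwa [alternate, alternate, if_neg hl, if_pos hk, add_comm]
        · exact absurd (iff_of_false hl hk) hpar
      have hlk : l ≠ k := fun h => hpar (by rw [h])
      rw [integral_sectorFun_mul_of_odd n hodd, if_neg hlk]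
      simp
  refine ⟨HilbertBasis.mkOfOrthogonalEqBot hort ?_, fun l => by
    rw [HilbertBasis.coe_mkOfOrthogonalEqBot]; exact hv l⟩
  rw [Submodule.eq_bot_iff]
  intro f hf
  have hinner : ∀ l, ∫ x, (sectorFun n (alternate a a' l) (l / 2) x : ℂ) * f x = 0 := by
    intro l
    have h1 : inner ℂ (v l) f = 0 :=
      (Submodule.mem_orthogonal _ _).1 hf (v l) (Submodule.subset_span ⟨l, rfl⟩)
    rw [L2.inner_def] at h1
    rw [← h1]
    refine integral_congr_ae ?_
    filter_upwards [hv l] with x hx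
    rw [hx, RCLike.inner_apply, Complex.conj_ofReal, mul_comm]
  have hfm : Measurable (f : ℝ → ℂ) := (Lp.stronglyMeasurable f).measurable
  have hprod : ∀ l, Integrable fun x =>
      (sectorFun n (alternate a a' l) (l / 2) x : ℂ) * f x := fun l =>
    (hmem l).integrable_mul (Lp.memLp f)
  have hre : (fun x => (f x).re) =ᵐ[volume] 0 := by
    refine ae_eq_zero_of_integral_mul_sectorFun hn haa (Complex.measurable_re.comp hfm)
      (Lp.memLp f).re fun l => ?_
    have h1 := congrArg Complex.re (hinner l)
    rw [← Complex.reCLM_apply, ← Complex.reCLM.integral_comp_comm (hprod l)] at h1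
    simpa [mul_comm] using h1
  have him : (fun x => (f x).im) =ᵐ[volume] 0 := by
    refine ae_eq_zero_of_integral_mul_sectorFun hn haa (Complex.measurable_im.comp hfm)
      (Lp.memLp f).im fun l => ?_
    have h1 := congrArg Complex.im (hinner l)
    rw [← Complex.imCLM_apply, ← Complex.imCLM.integral_comp_comm (hprod l)] at h1
    simpa [mul_comm] using h1
  rw [Lp.eq_zero_iff_ae_eq_zero]
  filter_upwards [hre, him] with x h1 h2
  exact Complex.ext h1 h2

/-! ### The weights -/

section

variable {n : ℕ}

/-- The weight with Bessel function of order `μ`; both `ρ₁` and `ρ₂` are of this form. -/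
noncomputable def besselWeight (n : ℕ) (μ : ℝ) (z : ℂ) : ℝ :=
  weightConst n * (‖z‖ ^ 2) ^ ((n : ℝ) - 1 / 2) * besselK μ ((‖z‖ ^ 2) ^ n / n)

lemma weightConst_pos (hn : 1 ≤ n) : 0 < weightConst n := by
  have hn0 : (0 : ℝ) < n := by exact_mod_cast hn
  have := Gamma_nu_pos hn
  have := Real.pi_pos
  unfold weightConst; positivity

lemma gammaShift_lt_one (hn : 1 ≤ n) {b : ℕ} (hb : b < n) : gammaShift n b < 1 := by
  have hn0 : (0 : ℝ) < n := by exact_mod_cast hn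
  rw [gammaShift, div_lt_one (by positivity)]
  have : (b : ℝ) + 1 ≤ n := by exact_mod_cast hb
  linarith

/-- For the order `1 - (2b + 1) / (2n)` the fractional powers in the weight cancel. -/
lemma besselWeight_eq (hn : 1 ≤ n) {b : ℕ} (hb : b < n) {z : ℂ} (hz : z ≠ 0) :
    besselWeight n (1 - gammaShift n b) z =
      weightConst n / 2 * (2 * n : ℝ) ^ (1 - gammaShift n b) *
        (‖z‖ ^ (2 * b) * besselInt (1 - gammaShift n b) ((‖z‖ ^ (2 * n) / (2 * n)) ^ 2)) := by
  have hn0 : (0 : ℝ) < n := by exact_mod_cast hn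
  have hr : 0 < ‖z‖ := norm_pos_iff.2 hz
  have hs := gammaShift_pos hn b
  have hs1 := gammaShift_lt_one hn hb
  set μ := 1 - gammaShift n b with hμ
  have hμn : 2 * n * μ = 2 * n - 1 - 2 * b := by
    rw [hμ, gammaShift]; field_simp; ring
  rw [besselWeight, besselK_eq (by linarith) (by linarith) (by positivity)]
  have e1 : (‖z‖ ^ 2) ^ n / n / 2 = ‖z‖ ^ (2 * n) / (2 * n) := by
    rw [← pow_mul]; field_simp
  rw [e1, Real.div_rpow (by positivity) (by positivity), Real.rpow_neg (by positivity) μ,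
    Real.rpow_neg (by positivity) μ]
  have e2 : (‖z‖ ^ 2) ^ ((n : ℝ) - 1 / 2) = ‖z‖ ^ (2 * b) * (‖z‖ ^ (2 * n)) ^ μ := by
    rw [← Real.rpow_natCast, ← Real.rpow_natCast, ← Real.rpow_natCast, ← Real.rpow_mul hr.le,
      ← Real.rpow_mul hr.le, ← Real.rpow_add hr]
    congr 1
    push_cast
    linarith
  rw [e2]
  have h1 : 0 < (‖z‖ ^ (2 * n)) ^ μ := by positivity
  have h2 : 0 < (2 * n : ℝ) ^ μ := by positivity
  field_simp

lemma besselWeight_zero (hn : 1 ≤ n) (μ : ℝ) : besselWeight n μ 0 = 0 := by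
  have hn0 : (1 : ℝ) ≤ n := by exact_mod_cast hn
  rw [besselWeight, norm_zero, zero_pow two_ne_zero, Real.zero_rpow (by linarith)]
  ring

lemma besselWeight_nonneg (hn : 1 ≤ n) {b : ℕ} (hb : b < n) (z : ℂ) :
    0 ≤ besselWeight n (1 - gammaShift n b) z := by
  rcases eq_or_ne z 0 with rfl | hz
  · rw [besselWeight_zero hn]
  · rw [besselWeight_eq hn hb hz]
    have := weightConst_pos hn
    have := besselInt_nonneg (1 - gammaShift n b) ((‖z‖ ^ (2 * n) / (2 * n)) ^ 2)
    positivity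

lemma measurable_besselWeight (hn : 1 ≤ n) {b : ℕ} (hb : b < n) :
    Measurable (besselWeight n (1 - gammaShift n b)) := by
  have hs := gammaShift_pos hn b
  have hs1 := gammaShift_lt_one hn hb
  set μ := 1 - gammaShift n b with hμ
  have hV : ∀ c : ℝ, 0 < c → Measurable (besselV c) := fun c hc =>
    (continuous_iff_continuousAt.2 fun w => (hasDerivAt_besselV hc w).continuousAt).measurable
  have h1 := hV (1 + μ) (by linarith)
  have h2 := hV (1 + -μ) (by linarith)
  have hK : Measurable (besselK μ) := by
    unfold besselK
    simp only [besselI_eq]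
    fun_prop
  unfold besselWeight
  fun_prop

lemma besselWeight_le (hn : 1 ≤ n) {b : ℕ} (hb : b < n) : ∃ C : ℝ, 0 ≤ C ∧ ∀ z : ℂ,
    besselWeight n (1 - gammaShift n b) z ≤
      C * ‖z‖ ^ (2 * b) * Real.exp (-(3 / (4 * n)) * ‖z‖ ^ (2 * n)) := by
  have hn0 : (0 : ℝ) < n := by exact_mod_cast hn
  have hs1 := gammaShift_lt_one hn hb
  set μ := 1 - gammaShift n b with hμ
  have hμ0 : 0 < μ := by linarith
  have hC := weightConst_pos hn
  have hG := Real.Gamma_pos_of_pos hμ0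
  refine ⟨weightConst n / 2 * (2 * n : ℝ) ^ μ * ((1 / (1 / 4)) ^ μ * Real.Gamma μ),
    by positivity, fun z => ?_⟩
  rcases eq_or_ne z 0 with rfl | hz
  · rw [besselWeight_zero hn]; positivity
  · rw [besselWeight_eq hn hb hz, ← hμ]
    have h := besselInt_le hμ0 (y := ‖z‖ ^ (2 * n) / (2 * n))
    calc _ ≤ weightConst n / 2 * (2 * n : ℝ) ^ μ * (‖z‖ ^ (2 * b) *
          ((1 / (1 / 4)) ^ μ * Real.Gamma μ *
            Real.exp (-(3 / 2) * (‖z‖ ^ (2 * n) / (2 * n))))) := by gcongr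
      _ = _ := by
        rw [show -(3 / 2) * (‖z‖ ^ (2 * n) / (2 * n)) = -(3 / (4 * n)) * ‖z‖ ^ (2 * n) by
          field_simp; ring]
        ring

lemma integrable_norm_pow_mul_exp (hn : 1 ≤ n) (N : ℕ) {c : ℝ} (hc : 0 < c) :
    Integrable fun z : ℂ => ‖z‖ ^ N * Real.exp (-c * ‖z‖ ^ (2 * n)) := by
  have h := (integrable_fun_norm_addHaar (volume : Measure ℂ)
    (f := fun r : ℝ => r ^ N * Real.exp (-c * r ^ (2 * n)))).2
  refine h ?_
  refine ((integrable_pow_mul_exp hn (1 + N) hc).integrableOn (s := Set.Ioi 0)).congr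
    (ae_of_all _ fun r => ?_)
  simp only [Complex.finrank_real_complex, smul_eq_mul]
  rw [pow_add]; ring

lemma integrable_pow_mul_besselWeight (hn : 1 ≤ n) {b : ℕ} (hb : b < n) (N : ℕ) :
    Integrable fun z : ℂ => ‖z‖ ^ N * besselWeight n (1 - gammaShift n b) z := by
  have hn0 : (0 : ℝ) < n := by exact_mod_cast hn
  obtain ⟨C, -, h⟩ := besselWeight_le hn hb
  have hm := measurable_besselWeight hn hb
  refine ((integrable_norm_pow_mul_exp hn (N + 2 * b) (c := 3 / (4 * n))
    (by positivity)).const_mul C).mono' (by fun_prop) (ae_of_all _ fun z => ?_)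
  rw [Real.norm_eq_abs, abs_of_nonneg (mul_nonneg (by positivity) (besselWeight_nonneg hn hb z))]
  calc _ ≤ ‖z‖ ^ N * (C * ‖z‖ ^ (2 * b) * Real.exp (-(3 / (4 * n)) * ‖z‖ ^ (2 * n))) := by
        gcongr; exact h z
    _ = _ := by rw [pow_add]; ring

/-- The substitution `w = (r ^ (2n) / (2n)) ^ 2` in the Mellin transform of `besselInt`. -/
lemma integral_pow_mul_besselInt (hn : 1 ≤ n) {μ : ℝ} (hμ : 0 < μ) (N : ℕ) :
    ∫ r in Set.Ioi (0 : ℝ), r ^ (2 * N + 1) * besselInt μ ((r ^ (2 * n) / (2 * n)) ^ 2) =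
      1 / (4 * n) * (2 * n : ℝ) ^ (2 * ((N + 1 : ℝ) / (2 * n))) *
        (Real.Gamma ((N + 1 : ℝ) / (2 * n)) * Real.Gamma ((N + 1 : ℝ) / (2 * n) + μ)) := by
  have hn0 : (0 : ℝ) < n := by exact_mod_cast hn
  set q : ℝ := (N + 1 : ℝ) / (2 * n) with hq
  have hq0 : 0 < q := by positivity
  set g : ℝ → ℝ := fun t => t ^ (q - 1) * besselInt μ (t / (2 * n) ^ 2)
  have h1 := integral_comp_rpow_Ioi_of_pos (g := g) (p := 4 * n) (by positivity)
  have h2 := integral_comp_mul_left_Ioi g 0 (b := (2 * n : ℝ) ^ 2) (by positivity)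
  rw [mul_zero] at h2
  have hb0 : (0 : ℝ) < (2 * n) ^ 2 := by positivity
  have h3 : ∫ w in Set.Ioi (0 : ℝ), g ((2 * n) ^ 2 * w) =
      ((2 * n : ℝ) ^ 2) ^ (q - 1) * (Real.Gamma q * Real.Gamma (q + μ)) := by
    rw [← (besselInt_moment hμ hq0).2, ← integral_const_mul]
    refine setIntegral_congr_fun measurableSet_Ioi fun w hw => ?_
    have hw : 0 < w := hw
    simp only [g]
    rw [Real.mul_rpow hb0.le hw.le, mul_div_cancel_left₀ _ hb0.ne']
    ring
  rw [h3, smul_eq_mul, eq_inv_mul_iff_mul_eq₀ hb0.ne', ← h1] at h2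
  have h4 : ∫ x in Set.Ioi (0 : ℝ), (4 * n * x ^ ((4 : ℝ) * n - 1)) • g (x ^ ((4 : ℝ) * n)) =
      4 * n * ∫ r in Set.Ioi (0 : ℝ),
        r ^ (2 * N + 1) * besselInt μ ((r ^ (2 * n) / (2 * n)) ^ 2) := by
    rw [← integral_const_mul]
    refine setIntegral_congr_fun measurableSet_Ioi fun r hr => ?_
    have hr : 0 < r := hr
    simp only [g, smul_eq_mul]
    have e1 : r ^ ((4 : ℝ) * n - 1) * (r ^ ((4 : ℝ) * n)) ^ (q - 1) = r ^ (2 * N + 1) := by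
      rw [← Real.rpow_mul hr.le, ← Real.rpow_add hr, ← Real.rpow_natCast]
      congr 1
      rw [hq]; push_cast; field_simp; ring
    have e2 : r ^ ((4 : ℝ) * n) / (2 * n) ^ 2 = (r ^ (2 * n) / (2 * n)) ^ 2 := by
      rw [div_pow, ← pow_mul, ← Real.rpow_natCast r]
      congr 2; push_cast; ring
    rw [e2, ← e1]; ring
  rw [h4] at h2
  have e3 : ((2 * n : ℝ) ^ 2) ^ (q - 1) * (2 * n : ℝ) ^ 2 = (2 * n : ℝ) ^ (2 * q) := by
    rw [← Real.rpow_add_one hb0.ne', ← Real.rpow_natCast, ← Real.rpow_mul (by positivity)]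
    congr 1; push_cast; ring
  have h5 : 4 * n * (∫ r in Set.Ioi (0 : ℝ),
      r ^ (2 * N + 1) * besselInt μ ((r ^ (2 * n) / (2 * n)) ^ 2)) =
      (2 * n : ℝ) ^ (2 * q) * (Real.Gamma q * Real.Gamma (q + μ)) := by
    rw [← h2, ← e3]; ring
  rw [mul_assoc, ← h5]
  field_simp

/-- The monomials `z ^ (2nk + a)` with `a = b` or `a = 2n - 1 - b` are normalized. -/
lemma integral_sectorCoeff_sq_mul_besselWeight (hn : 1 ≤ n) {a b : ℕ} (hb : b < n)
    (hab : a = b ∨ a + b + 1 = 2 * n) (k : ℕ) :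
    ∫ z : ℂ, (sectorCoeff n a k * ‖z‖ ^ (2 * n * k + a)) ^ 2 *
      besselWeight n (1 - gammaShift n b) z = 1 := by
  have hn0 : (0 : ℝ) < n := by exact_mod_cast hn
  have hs1 := gammaShift_lt_one hn hb
  have hμ0 : 0 < 1 - gammaShift n b := by linarith
  set μ := 1 - gammaShift n b with hμ
  set N : ℕ := 2 * n * k + a + b with hN
  set K : ℝ := sectorCoeff n a k ^ 2 * (weightConst n / 2 * (2 * n : ℝ) ^ μ) with hK
  have hne : ∀ᵐ z : ℂ, z ≠ 0 := by simp [ae_iff]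
  have h1 : ∫ z : ℂ, (sectorCoeff n a k * ‖z‖ ^ (2 * n * k + a)) ^ 2 * besselWeight n μ z =
      ∫ z : ℂ, K * (‖z‖ ^ (2 * N) * besselInt μ ((‖z‖ ^ (2 * n) / (2 * n)) ^ 2)) := by
    refine integral_congr_ae ?_
    filter_upwards [hne] with z hz
    rw [besselWeight_eq hn hb hz, ← hμ, hK, hN,
      show 2 * (2 * n * k + a + b) = (2 * n * k + a) * 2 + 2 * b by ring, pow_add, pow_mul]
    ring
  rw [h1, integral_const_mul, integral_fun_norm_addHaar (volume : Measure ℂ)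
    (fun r : ℝ => r ^ (2 * N) * besselInt μ ((r ^ (2 * n) / (2 * n)) ^ 2))]
  have hball : (volume : Measure ℂ).real (Metric.ball 0 1) = Real.pi := by
    simp [Measure.real, Complex.volume_ball]
  rw [hball, Complex.finrank_real_complex]
  have h2 : ∫ y in Set.Ioi (0 : ℝ), y ^ (2 - 1) •
      (y ^ (2 * N) * besselInt μ ((y ^ (2 * n) / (2 * n)) ^ 2)) =
      ∫ r in Set.Ioi (0 : ℝ), r ^ (2 * N + 1) * besselInt μ ((r ^ (2 * n) / (2 * n)) ^ 2) := by
    congr 1 with r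
    rw [smul_eq_mul, pow_succ]; ring
  rw [h2, integral_pow_mul_besselInt hn hμ0]
  set q : ℝ := (N + 1 : ℝ) / (2 * n) with hq
  have hsum : 2 * q + μ = 2 * k + gammaShift n a + 1 := by
    rw [hq, hμ, hN, gammaShift, gammaShift]; push_cast; field_simp; ring
  -- the two Gamma factors are those of the normalization, in one order or the other
  have hGG : Real.Gamma q * Real.Gamma (q + μ) =
      Real.Gamma (k + gammaShift n a) * k.factorial := by
    have hqa : q = k + (a + b + 1) / (2 * n) := by
      rw [hq, hN]; push_cast; field_simp; ring
    rcases hab with h | h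
    · have h3 : q = k + gammaShift n a := by rw [hqa, gammaShift, ← h]; ring
      have h4 : q + μ = k + 1 := by linarith
      rw [h4, h3, Real.Gamma_nat_eq_factorial]
    · have h0 : (a : ℝ) + b + 1 = 2 * n := by exact_mod_cast h
      have h3 : q = k + 1 := by rw [hqa, h0, div_self (by positivity)]
      have h4 : q + μ = k + gammaShift n a := by linarith
      rw [h4, h3, Real.Gamma_nat_eq_factorial, mul_comm]
  have hG := Gamma_shift_pos hn a k
  have hGν := Gamma_nu_pos hn
  have hpi := Real.pi_pos
  rw [hGG, hK, sectorCoeff_sq hn, weightConst]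
  have e : (2 * n : ℝ) ^ μ * (2 * n : ℝ) ^ (2 * q) =
      (2 * n : ℝ) ^ (2 * (k : ℝ) + (gammaShift n a - 1 / (2 * n))) *
        (2 * n : ℝ) ^ (1 / (2 * n : ℝ)) * (2 * n) := by
    rw [← Real.rpow_add (by positivity), ← Real.rpow_add (by positivity),
      ← Real.rpow_add_one (by positivity)]
    congr 1
    linarith
  have p1 : 0 < (2 * n : ℝ) ^ (2 * (k : ℝ) + (gammaShift n a - 1 / (2 * n))) := by positivity
  have p2 : 0 < (2 * n : ℝ) ^ (1 / (2 * n : ℝ)) := by positivity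
  generalize (2 * n : ℝ) ^ (2 * (k : ℝ) + (gammaShift n a - 1 / (2 * n))) = P1 at *
  generalize (2 * n : ℝ) ^ (1 / (2 * n : ℝ)) = P2 at *
  generalize (2 * n : ℝ) ^ μ = P3 at *
  generalize (2 * n : ℝ) ^ (2 * q) = P4 at *
  simp only [smul_eq_mul, nsmul_eq_mul]
  generalize Real.Gamma (1 / (2 * n : ℝ)) = Gν at *
  have hk : (0 : ℝ) < k.factorial := by positivity
  have hmain : Gν / (P1 * Real.Gamma (k + gammaShift n a) * k.factorial) *
      (2 / (P2 * Real.pi * Gν) / 2 * P3) * (((2 : ℕ) : ℝ) * (Real.pi *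
      (1 / (4 * n) * P4 * (Real.Gamma (k + gammaShift n a) * k.factorial)))) =
      (P3 * P4) / (P1 * P2 * (2 * n)) := by
    push_cast
    field_simp
    ring
  rw [hmain, e]
  exact div_self (by positivity)

/-! ### Growth of the kernels -/

/-- The Bessel-type series in the kernel grows more slowly, in `z`, than `e^(ε |z|^(2n))`
for every `ε > 0`. With `ε = 1 / (8n)` and the factor `e^(-z^(2n)/(2n))` the total rate is `5 / (8n)`,
which is below the rate `3 / (4n)` at which the weight decays. -/
lemma norm_sectorKernel_le (hn : 1 ≤ n) (a : ℕ) (x : ℝ) : ∃ C : ℝ, 0 ≤ C ∧ ∀ z : ℂ,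
    ‖sectorKernel n a z x‖ ≤ C * ‖z‖ ^ a * Real.exp (5 / (8 * n) * ‖z‖ ^ (2 * n)) := by
  have hn0 : (0 : ℝ) < n := by exact_mod_cast hn
  set ε : ℝ := 1 / (8 * n) with hε
  have hε0 : 0 < ε := by positivity
  set y : ℝ := 2 * |x| ^ (2 * n) / (2 * n) ^ 2 with hy
  have hsum := summable_pow_div_Gamma (gammaShift_pos hn a) (y / ε)
  set M : ℝ := ∑' l : ℕ, (y / ε) ^ l / Real.Gamma (l + gammaShift n a)
  -- as `Γ` grows superexponentially, the terms of the series stay bounded for the ratio `y / ε`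
  have hterm0 : ∀ l : ℕ, 0 ≤ (y / ε) ^ l / Real.Gamma (l + gammaShift n a) := fun l => by
    have := Gamma_shift_pos hn a l
    positivity
  have hM : ∀ l : ℕ, (y / ε) ^ l / Real.Gamma (l + gammaShift n a) ≤ M := fun l =>
    hsum.le_tsum l fun j _ => hterm0 j
  have hM0 : 0 ≤ M := (hterm0 0).trans (hM 0)
  have hseries : ∀ z : ℂ, ‖∑' l, (besselCoeff n a l : ℂ) * (z * x) ^ (2 * n * l + a)‖ ≤
      M * (‖z‖ * |x|) ^ a * Real.exp (ε * ‖z‖ ^ (2 * n)) := by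
    intro z
    have hexp : HasSum (fun l : ℕ => (ε * ‖z‖ ^ (2 * n)) ^ l / l.factorial)
        (Real.exp (ε * ‖z‖ ^ (2 * n))) := by
      rw [Real.exp_eq_exp_ℝ]
      exact NormedSpace.expSeries_div_hasSum_exp _
    refine tsum_of_norm_bounded (hexp.mul_left (M * (‖z‖ * |x|) ^ a)) fun l => ?_
    have hG := Gamma_shift_pos hn a l
    have h1 : ‖(besselCoeff n a l : ℂ) * (z * x) ^ (2 * n * l + a)‖ =
        (y / ε) ^ l / Real.Gamma (l + gammaShift n a) *
          ((‖z‖ * |x|) ^ a * ((ε * ‖z‖ ^ (2 * n)) ^ l / l.factorial)) := by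
      rw [norm_mul, norm_pow, norm_mul, Complex.norm_real, Complex.norm_real, Real.norm_eq_abs,
        Real.norm_eq_abs, abs_of_pos (besselCoeff_pos hn a l), besselCoeff, hy, pow_add,
        mul_pow ε, div_pow _ ε, div_pow _ ((2 * n : ℝ) ^ 2), mul_pow 2 (|x| ^ (2 * n)),
        mul_pow ‖z‖ |x| (2 * n * l), pow_mul |x|, pow_mul ‖z‖ (2 * n), ← pow_mul (2 * n : ℝ)]
      field_simp
    rw [h1, mul_assoc M]
    exact mul_le_mul_of_nonneg_right (hM l) (by positivity)
  set Ex : ℝ := ‖Complex.exp (-(x : ℂ) ^ (2 * n) / (2 * n))‖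
  refine ⟨sectorConst n a * M * |x| ^ a * Ex, ?_, fun z => ?_⟩
  · have := sectorConst_pos hn a
    positivity
  · have h1 : ‖Complex.exp (-z ^ (2 * n) / (2 * n))‖ ≤
        Real.exp (1 / (2 * n) * ‖z‖ ^ (2 * n)) := by
      refine (Complex.norm_exp_le_exp_norm _).trans (le_of_eq ?_)
      rw [norm_div, norm_neg, norm_pow, norm_mul, Complex.norm_natCast, Complex.norm_ofNat]
      congr 1; ring
    rw [sectorKernel, norm_mul, norm_mul, norm_mul, Complex.norm_real, Real.norm_eq_abs,
      abs_of_pos (sectorConst_pos hn a)]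
    have h2 := hseries z
    have h3 := sectorConst_pos hn a
    calc _ ≤ Real.exp (1 / (2 * n) * ‖z‖ ^ (2 * n)) * (sectorConst n a *
          (M * (‖z‖ * |x|) ^ a * Real.exp (ε * ‖z‖ ^ (2 * n)))) * Ex := by gcongr
      _ = _ := by
        have : Real.exp (5 / (8 * n) * ‖z‖ ^ (2 * n)) =
            Real.exp (1 / (2 * n) * ‖z‖ ^ (2 * n)) * Real.exp (ε * ‖z‖ ^ (2 * n)) := by
          rw [← Real.exp_add]; congr 1; rw [hε]; field_simp; ring
        rw [this, mul_pow]; ring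

lemma integrable_sectorKernel_mul (hn : 1 ≤ n) {b : ℕ} (hb : b < n) (a N : ℕ) (x : ℝ) :
    Integrable fun z : ℂ => sectorKernel n a (conj z) x * z ^ N *
      (besselWeight n (1 - gammaShift n b) z : ℂ) := by
  have hn0 : (0 : ℝ) < n := by exact_mod_cast hn
  obtain ⟨C, hC, h1⟩ := besselWeight_le hn hb
  obtain ⟨C', hC', h2⟩ := norm_sectorKernel_le hn a x
  have hm := measurable_besselWeight hn hb
  have hk : Measurable fun z => sectorKernel n a z x :=
    Measurable.of_hasSum
      (f := fun k z => ((sectorCoeff n a k : ℂ) * z ^ (2 * n * k + a)) * (sectorFun n a k x : ℂ))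
      (fun k => by fun_prop) (fun z => hasSum_sectorKernel hn a z x)
  have hk' := hk.comp Complex.continuous_conj.measurable
  refine ((integrable_norm_pow_mul_exp hn (a + N + 2 * b) (c := 1 / (8 * n))
    (by positivity)).const_mul (C' * C)).mono' ?_ (ae_of_all _ fun z => ?_)
  · exact ((hk'.mul (by fun_prop)).mul (Complex.measurable_ofReal.comp hm)).aestronglyMeasurable
  · rw [norm_mul, norm_mul, norm_pow, Complex.norm_real, Real.norm_eq_abs,
      abs_of_nonneg (besselWeight_nonneg hn hb z)]
    have h3 := h2 (conj z)
    rw [Complex.norm_conj] at h3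
    have h4 := besselWeight_nonneg hn hb z
    calc _ ≤ (C' * ‖z‖ ^ a * Real.exp (5 / (8 * n) * ‖z‖ ^ (2 * n))) * ‖z‖ ^ N *
          (C * ‖z‖ ^ (2 * b) * Real.exp (-(3 / (4 * n)) * ‖z‖ ^ (2 * n))) := by
          gcongr; exact h1 z
      _ = _ := by
        have : Real.exp (-(1 / (8 * n)) * ‖z‖ ^ (2 * n)) =
            Real.exp (5 / (8 * n) * ‖z‖ ^ (2 * n)) *
              Real.exp (-(3 / (4 * n)) * ‖z‖ ^ (2 * n)) := by
          rw [← Real.exp_add]; congr 1; field_simp; ring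
        rw [this, pow_add, pow_add]; ring

end

/-! ### The two transforms -/

/-- The kernel with the two sectors `b` and `2n - 1 - b` and the weight of order
`1 - (2b + 1) / (2n)`; the two transforms are the cases `b = 0` and `b = n - 1`. -/
theorem exists_diagonalKernel {n : ℕ} (hn : 1 ≤ n) {b b' : ℕ} (hb : b < n)
    (hbb : b' + b + 1 = 2 * n) :
    ∃ (B : HilbertBasis ℕ ℂ H) (ψ : ℕ → ℝ → ℝ),
      DiagonalKernel B ψ (fun l => sectorCoeff n (alternate b b' l) (l / 2))
        (fun l => 2 * n * (l / 2) + alternate b b' l)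
        (fun z x => sectorKernel n b z x + sectorKernel n b' z x)
        (besselWeight n (1 - gammaShift n b)) := by
  have hodd : Odd (b + b') := ⟨n - 1, by omega⟩
  obtain ⟨B, hB⟩ := exists_hilbertBasis hn hodd
  have hab : ∀ l, alternate b b' l = b ∨ alternate b b' l + b + 1 = 2 * n := fun l => by
    unfold alternate; split_ifs
    · exact Or.inl rfl
    · exact Or.inr hbb
  have heven : ∀ k : ℕ, alternate b b' (2 * k) = b := fun k => by simp [alternate]
  have hodd' : ∀ k : ℕ, alternate b b' (2 * k + 1) = b' := fun k => by simp [alternate]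
  have hdiv : ∀ k : ℕ, (2 * k + 1) / 2 = k := fun k => by omega
  refine ⟨B, fun l => sectorFun n (alternate b b' l) (l / 2), hB,
    fun l => (sectorCoeff_pos hn _ _).ne', ?_, fun z x => ?_, fun r => ?_,
    measurable_besselWeight hn hb, besselWeight_nonneg hn hb, ?_, fun R => ?_, fun l => ?_,
    fun l => integral_sectorCoeff_sq_mul_besselWeight hn hb (hab l) (l / 2), fun l x => ?_⟩
  · intro l k hlk
    simp only at hlk
    have hlt : ∀ l, alternate b b' l < 2 * n := fun l => by
      unfold alternate; split_ifs <;> omega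
    have h1 : l / 2 = k / 2 := by
      have := congrArg (· / (2 * n)) hlk
      simpa [Nat.mul_add_div (show 0 < 2 * n by omega), Nat.div_eq_of_lt (hlt _)] using this
    have h2 : alternate b b' l = alternate b b' k := by
      rw [h1] at hlk; exact Nat.add_left_cancel hlk
    unfold alternate at h2
    split_ifs at h2 with hl hk hk
    · grind
    · omega
    · omega
    · grind
  · refine HasSum.even_add_odd ?_ ?_
    · simpa [heven] using hasSum_sectorKernel hn b z x
    · simpa only [hodd', hdiv] using hasSum_sectorKernel hn b' z x
  · refine (HasSum.even_add_odd (f := fun l => (sectorCoeff n (alternate b b' l) (l / 2) *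
      r ^ (2 * n * (l / 2) + alternate b b' l)) ^ 2)
      (m := ∑' k, (sectorCoeff n b k * r ^ (2 * n * k + b)) ^ 2)
      (m' := ∑' k, (sectorCoeff n b' k * r ^ (2 * n * k + b')) ^ 2) ?_ ?_).summable
    · simpa [heven] using (summable_sectorCoeff_sq hn b r).hasSum
    · simpa only [hodd', hdiv] using (summable_sectorCoeff_sq hn b' r).hasSum
  · intro z w h
    simp only [besselWeight, h]
  · have := integrable_pow_mul_besselWeight hn hb 0
    simp only [pow_zero, one_mul] at this
    exact this.integrableOn
  · refine ((integrable_pow_mul_besselWeight hn hb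
      ((2 * n * (l / 2) + alternate b b' l) * 2)).const_mul
      (sectorCoeff n (alternate b b' l) (l / 2) ^ 2)).congr (ae_of_all _ fun z => ?_)
    simp only
    rw [pow_mul]; ring
  · refine ((integrable_sectorKernel_mul hn hb b (2 * n * (l / 2) + alternate b b' l) x).add
      (integrable_sectorKernel_mul hn hb b' (2 * n * (l / 2) + alternate b b' l) x)).congr
      (ae_of_all _ fun z => ?_)
    simp only [Pi.add_apply]
    ring

lemma gammaShift_zero (n : ℕ) : gammaShift n 0 = 1 / (2 * n) := by
  simp [gammaShift]

lemma gammaShift_two_mul_sub_one {n : ℕ} (hn : 1 ≤ n) :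
    gammaShift n (2 * n - 1) = 2 - 1 / (2 * n) := by
  have hn0 : (0 : ℝ) < n := by exact_mod_cast hn
  rw [gammaShift, Nat.cast_sub (by omega)]
  push_cast; field_simp; ring

lemma gammaShift_sub_one {n : ℕ} (hn : 1 ≤ n) : gammaShift n (n - 1) = 1 - 1 / (2 * n) := by
  have hn0 : (0 : ℝ) < n := by exact_mod_cast hn
  rw [gammaShift, Nat.cast_sub hn]
  push_cast; field_simp; ring

lemma gammaShift_self {n : ℕ} (hn : 1 ≤ n) : gammaShift n n = 1 + 1 / (2 * n) := by
  have hn0 : (0 : ℝ) < n := by exact_mod_cast hn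
  rw [gammaShift]; field_simp

lemma sectorConst_zero (n : ℕ) : sectorConst n 0 = alpha n := by
  rw [sectorConst, alpha, gammaShift_zero]
  simp only [sub_self, neg_zero, zero_div, Real.rpow_zero, one_mul, sub_zero]
  congr 2
  ring

lemma sectorConst_two_mul_sub_one {n : ℕ} (hn : 1 ≤ n) :
    sectorConst n (2 * n - 1) * (2 * n) = beta n * (2 : ℝ) ^ (1 / 2 : ℝ) := by
  have hn0 : (0 : ℝ) < n := by exact_mod_cast hn
  rw [sectorConst, beta, gammaShift_two_mul_sub_one hn]
  have e1 : (2 : ℝ) ^ (-(2 - 1 / (2 * n) - 1 / (2 * n)) / 2 : ℝ) * 2 =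
      (2 : ℝ) ^ (-(1 / 2) + 1 / (2 * n) : ℝ) * (2 : ℝ) ^ (1 / 2 : ℝ) := by
    rw [← Real.rpow_add_one (by norm_num), ← Real.rpow_add (by norm_num)]
    congr 1; ring
  have e2 : (n : ℝ) ^ (1 / 2 - 1 / (2 * n) / 2 - (2 - 1 / (2 * n) - 1 / (2 * n)) : ℝ) * n =
      (n : ℝ) ^ (-(1 / 2) + 3 / (4 * n) : ℝ) := by
    rw [← Real.rpow_add_one hn0.ne']
    congr 1; ring
  rw [← e2]
  linear_combination ((n : ℝ) ^ (1 / 2 - 1 / (2 * n) / 2 - (2 - 1 / (2 * n) - 1 / (2 * n)) : ℝ) *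
    n * √(Real.Gamma (1 / (2 * n)))) * e1

lemma sectorConst_sub_one {n : ℕ} (hn : 1 ≤ n) : sectorConst n (n - 1) = beta n := by
  rw [sectorConst, beta, gammaShift_sub_one hn]
  congr 3 <;> ring

lemma sectorConst_self {n : ℕ} (hn : 1 ≤ n) :
    sectorConst n n * (2 * n) = alpha n * (2 : ℝ) ^ (1 / 2 : ℝ) := by
  have hn0 : (0 : ℝ) < n := by exact_mod_cast hn
  rw [sectorConst, alpha, gammaShift_self hn]
  have e1 : (2 : ℝ) ^ (-(1 + 1 / (2 * n) - 1 / (2 * n)) / 2 : ℝ) * 2 = (2 : ℝ) ^ (1 / 2 : ℝ) := by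
    rw [← Real.rpow_add_one (by norm_num)]
    congr 1; ring
  have e2 : (n : ℝ) ^ (1 / 2 - 1 / (2 * n) / 2 - (1 + 1 / (2 * n) - 1 / (2 * n)) : ℝ) * n =
      (n : ℝ) ^ (1 / 2 - 1 / (4 * n) : ℝ) := by
    rw [← Real.rpow_add_one hn0.ne']
    congr 1; ring
  rw [← e1, ← e2]
  ring

/-- The sector of the odd positions, in the form in which the reduced kernels state it: a factor
`2n` and the square root of `2` move from the coefficients into the constant. -/
lemma sectorConst_mul_tsum {n a : ℕ} (hn : 1 ≤ n) {s c : ℝ} (hs : gammaShift n a = s)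
    (hc : sectorConst n a * (2 * n) = c * (2 : ℝ) ^ (1 / 2 : ℝ)) (w : ℂ) :
    (sectorConst n a : ℂ) * ∑' l, (besselCoeff n a l : ℂ) * w ^ (2 * n * l + a) =
      (c : ℂ) * ∑' l : ℕ, (((2 : ℝ) ^ ((l : ℝ) + 1 / 2) / ((2 * n : ℝ) ^ (2 * l + 1) *
        Real.Gamma (l + s) * (l.factorial : ℝ)) : ℝ) : ℂ) * w ^ (2 * n * l + a) := by
  have hn0 : (0 : ℝ) < n := by exact_mod_cast hn
  rw [← tsum_mul_left, ← tsum_mul_left]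
  congr 1 with l
  rw [← mul_assoc, ← mul_assoc]
  congr 1
  norm_cast
  have hG := Gamma_shift_pos hn a l
  rw [besselCoeff, ← hs, Real.rpow_add (by norm_num), Real.rpow_natCast]
  push_cast
  rw [mul_div_assoc', mul_div_assoc', div_eq_div_iff (by positivity) (by positivity)]
  linear_combination (2 ^ l * (2 * n : ℝ) ^ (2 * l) * Real.Gamma (l + gammaShift n a) *
    l.factorial) * hc

theorem exists_diagonalKernel₁ {n : ℕ} (hn : 1 ≤ n) :
    ∃ (B : HilbertBasis ℕ ℂ H) (ψ : ℕ → ℝ → ℝ),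
      DiagonalKernel B ψ (coeff₁ n) (expo₁ n) (A₁ n) (rho₁ n) := by
  have h := exists_diagonalKernel hn (b := 0) (b' := 2 * n - 1) (by omega) (by omega)
  have hγ : (fun l => sectorCoeff n (alternate 0 (2 * n - 1) l) (l / 2)) = coeff₁ n := by
    funext l
    unfold alternate coeff₁
    split_ifs
    · rw [sectorCoeff, gammaShift_zero, sub_self, add_zero]
    · rw [sectorCoeff, gammaShift_two_mul_sub_one hn]
      congr 5
      · ring
      · ring
  have hm : (fun l => 2 * n * (l / 2) + alternate 0 (2 * n - 1) l) = expo₁ n := by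
    funext l
    unfold alternate expo₁
    split_ifs <;> rfl
  have hA : (fun z x => sectorKernel n 0 z x + sectorKernel n (2 * n - 1) z x) = A₁ n := by
    funext z x
    rw [A₁, kerB₁, sectorKernel, sectorKernel, ← add_mul, ← mul_add,
      sectorConst_mul_tsum hn (gammaShift_two_mul_sub_one hn) (sectorConst_two_mul_sub_one hn),
      sectorConst_zero]
    simp only [besselCoeff, gammaShift_zero, add_zero, add_sub_assoc]
  have hρ : besselWeight n (1 - gammaShift n 0) = rho₁ n := by
    rw [gammaShift_zero]; rfl
  rwa [hγ, hm, hA, hρ] at h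

theorem exists_diagonalKernel₂ {n : ℕ} (hn : 1 ≤ n) :
    ∃ (B : HilbertBasis ℕ ℂ H) (ψ : ℕ → ℝ → ℝ),
      DiagonalKernel B ψ (coeff₂ n) (expo₂ n) (A₂ n) (rho₂ n) := by
  have h := exists_diagonalKernel hn (b := n - 1) (b' := n) (by omega) (by omega)
  have hγ : (fun l => sectorCoeff n (alternate (n - 1) n l) (l / 2)) = coeff₂ n := by
    funext l
    unfold alternate coeff₂
    split_ifs
    · rw [sectorCoeff, gammaShift_sub_one hn]
      congr 5
      · ring
      · ring
    · rw [sectorCoeff, gammaShift_self hn]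
      congr 5
      · ring
      · ring
  have hm : (fun l => 2 * n * (l / 2) + alternate (n - 1) n l) = expo₂ n := by
    funext l
    unfold alternate expo₂
    split_ifs <;> rfl
  have hA : (fun z x => sectorKernel n (n - 1) z x + sectorKernel n n z x) = A₂ n := by
    funext z x
    rw [A₂, kerB₂, sectorKernel, sectorKernel, ← add_mul, ← mul_add,
      sectorConst_mul_tsum hn (gammaShift_self hn) (sectorConst_self hn),
      sectorConst_sub_one hn]
    simp only [besselCoeff, gammaShift_sub_one hn, add_sub_assoc, add_assoc]
  have hρ : besselWeight n (1 - gammaShift n (n - 1)) = rho₂ n := by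
    rw [gammaShift_sub_one hn, sub_sub_cancel]; rfl
  rwa [hγ, hm, hA, hρ] at h

end CoupledSUSY

theorem mainTheorem3 (n : ℕ) (hn : 1 ≤ n) :
    (∃ T : CoupledSUSY.H ≃ₗ[ℂ] CoupledSUSY.F₁ n,
      (∀ (f : CoupledSUSY.H) (z : ℂ),
        Integrable (fun x : ℝ => CoupledSUSY.A₁ n z x * f x) ∧
        (T f : ℂ → ℂ) z = CoupledSUSY.B₁ n f z) ∧
      -- the inverse is the mean-square limit of the integrals over discs
      (∀ f : CoupledSUSY.F₁ n,
        (∀ (R : ℝ) (x : ℝ),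
          IntegrableOn (CoupledSUSY.invIntegrand₁ n f x) (Metric.closedBall (0 : ℂ) R)) ∧
        (∀ R : ℝ, MemLp (fun x : ℝ =>
          ∫ z in Metric.closedBall (0 : ℂ) R, CoupledSUSY.invIntegrand₁ n f x z) 2 volume) ∧
        Tendsto (fun R : ℝ => eLpNorm (fun x : ℝ =>
          (∫ z in Metric.closedBall (0 : ℂ) R, CoupledSUSY.invIntegrand₁ n f x z)
            - T.symm f x) 2 volume) atTop (𝓝 0)) ∧
      -- the formula holds almost everywhere where the integral over `ℂ` converges absolutely
      (∀ f : CoupledSUSY.F₁ n, ∀ᵐ x : ℝ, Integrable (CoupledSUSY.invIntegrand₁ n f x) →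
        T.symm f x = ∫ z : ℂ, CoupledSUSY.invIntegrand₁ n f x z) ∧
      -- on the dense subspace `𝒪₁` it converges absolutely for all `x`
      (∀ f ∈ CoupledSUSY.O₁ n, f ∈ CoupledSUSY.F₁ n ∧
        ∀ x : ℝ, Integrable (CoupledSUSY.invIntegrand₁ n f x))) ∧
    (∃ T : CoupledSUSY.H ≃ₗ[ℂ] CoupledSUSY.F₂ n,
      (∀ (f : CoupledSUSY.H) (z : ℂ),
        Integrable (fun x : ℝ => CoupledSUSY.A₂ n z x * f x) ∧
        (T f : ℂ → ℂ) z = CoupledSUSY.B₂ n f z) ∧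
      (∀ f : CoupledSUSY.F₂ n,
        (∀ (R : ℝ) (x : ℝ),
          IntegrableOn (CoupledSUSY.invIntegrand₂ n f x) (Metric.closedBall (0 : ℂ) R)) ∧
        (∀ R : ℝ, MemLp (fun x : ℝ =>
          ∫ z in Metric.closedBall (0 : ℂ) R, CoupledSUSY.invIntegrand₂ n f x z) 2 volume) ∧
        Tendsto (fun R : ℝ => eLpNorm (fun x : ℝ =>
          (∫ z in Metric.closedBall (0 : ℂ) R, CoupledSUSY.invIntegrand₂ n f x z)
            - T.symm f x) 2 volume) atTop (𝓝 0)) ∧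
      (∀ f : CoupledSUSY.F₂ n, ∀ᵐ x : ℝ, Integrable (CoupledSUSY.invIntegrand₂ n f x) →
        T.symm f x = ∫ z : ℂ, CoupledSUSY.invIntegrand₂ n f x z) ∧
      (∀ f ∈ CoupledSUSY.O₂ n, f ∈ CoupledSUSY.F₂ n ∧
        ∀ x : ℝ, Integrable (CoupledSUSY.invIntegrand₂ n f x))) := by
  obtain ⟨_, _, D₁⟩ := CoupledSUSY.exists_diagonalKernel₁ hn
  obtain ⟨_, _, D₂⟩ := CoupledSUSY.exists_diagonalKernel₂ hn
  exact ⟨D₁.inversion, D₂.inversion⟩
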